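/- Let $k$ be an algebraically closed field and let $Q$ be a finite quiver without oriented cycles, with set of vertices $Q_0$. All representations of $Q$ are finite-dimensional over $k$. For a representation $M$ and $e\in\mathbb{Z}Q_0$ let $\mathrm{Gr}_e(M)$ be the quiver Grassmannian, i.e. the set of subrepresentations $U\subseteq M$ with $\underline{\dim}\,U=e$, viewed as a closed subvariety of $\prod_{p\in Q_0}\mathrm{Gr}(e_p,M_p)$; it is empty if $e\notin\mathbb{N}Q_0$. Write $[M,N]=\dim_k\mathrm{Hom}(M,N)$. Let $q\in Q_0$, let $S_q$ be the simple representation at $q$ and let $s_q$ be its dimension vector. Let \[0\to S_q\xrightarrow{\;i\;}B\xrightarrow{\;\pi\;}N\to 0\] be a short exact sequence with $\dim_k\mathrm{Hom}(S_q,B)=1$ and $\mathrm{Ext}^1(B,S_q)=0$. For $e\in\mathbb{Z}Q_0$ let $\Psi_e$ be the map $U\mapsto(i^{-1}(U),\pi(U))$ from $\mathrm{Gr}_e(B)$ to $\coprod_{f+g=e}\mathrm{Gr}_f(S_q)\times\mathrm{Gr}_g(N)$, and let \[\mathrm{Gr}_e^q(B)=\{U\in\mathrm{Gr}_e(B)\mid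 i(S_q)\subseteq U\},\qquad \mathrm{Gr}_e^0(B)=\{U\in\mathrm{Gr}_e(B)\mid U\cap i(S_q)=0\},\] with their structures of subvarieties of $\mathrm{Gr}_e(B)$. Then $\mathrm{Gr}_{s_q}(S_q)$ and $\mathrm{Gr}_0(S_q)$ are points, and $\Psi_e$ restricts to morphisms of varieties \[\Psi_e^q:\mathrm{Gr}_e^q(B)\to\mathrm{Gr}_{s_q}(S_q)\times\mathrm{Gr}_{e-s_q}(N)\cong\mathrm{Gr}_{e-s_q}(N),\] \[\Psi_e^0:\mathrm{Gr}_e^0(B)\to\mathrm{Gr}_{0}(S_q)\times\mathrm{Gr}_{e}(N)\cong\mathrm{Gr}_{e}(N).\] The morphism $\Psi_e^q$ is an isomorphism of varieties. For every $V\in\mathrm{Gr}_e(N)$ the fibre $(\Psi_e^0)^{-1}(V)$ is empty if $\mathrm{Ext}^1(V,S_q)\neq 0$, and it is isomorphic, as a variety, to the affine space $\mathbb{A}^{[V,S_q]}$ if $\mathrm{Ext}^1(V,S_q)=0$. -/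

import Mathlib

open CategoryTheory Module
open scoped Topology

universe u

noncomputable section

/-! ### Varieties as spaces with functions

A variety is described by its Zariski topology and its sheaf of regular functions with values in
the ground field. A regular function on an open set `W` is given by a function on the whole space
of which only the values on `W` matter. -/

/-- A topological space with a sheaf of `k`-algebras of `k`-valued functions. -/
structure SpaceWithFunctions (k : Type*) [Field k] (X : Type*) where
  top : TopologicalSpace X
  IsRegular : Set X → (X → k) → Prop
  congr : ∀ {W : Set X} {f g : X → k}, (∀ x ∈ W, f x = g x) → IsRegular W f → IsRegular W g
  mono : ∀ {W W' : Set X} {f : X → k}, W' ⊆ W → IsRegular W f → IsRegular W' f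
  glue : ∀ {W : Set X} {f : X → k},
    (∀ x ∈ W, ∃ O : Set X, IsOpen[top] O ∧ x ∈ O ∧ IsRegular (W ∩ O) f) → IsRegular W f
  const : ∀ (W : Set X) (c : k), IsRegular W (fun _ => c)
  add : ∀ {W : Set X} {f g : X → k}, IsRegular W f → IsRegular W g → IsRegular W (f + g)
  mul : ∀ {W : Set X} {f g : X → k}, IsRegular W f → IsRegular W g → IsRegular W (f * g)

namespace SpaceWithFunctions

/-- A morphism of varieties: a Zariski continuous map that pulls regular functions on open sets
back to regular functions. -/
def IsMorphism {k : Type*} [Field k] {X Y : Type*} (S : SpaceWithFunctions k X)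
    (T : SpaceWithFunctions k Y) (φ : X → Y) : Prop :=
  (∀ W : Set Y, IsOpen[T.top] W → IsOpen[S.top] (φ ⁻¹' W)) ∧
    ∀ (W : Set Y) (f : Y → k), IsOpen[T.top] W → T.IsRegular W f →
      S.IsRegular (φ ⁻¹' W) (f ∘ φ)

/-- An isomorphism of varieties: a morphism with an inverse morphism. -/
def IsIsomorphism {k : Type*} [Field k] {X Y : Type*} (S : SpaceWithFunctions k X)
    (T : SpaceWithFunctions k Y) (φ : X → Y) : Prop :=
  S.IsMorphism T φ ∧
    ∃ ψ : Y → X, T.IsMorphism S ψ ∧ Function.LeftInverse ψ φ ∧ Function.RightInverse ψ φ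

/-- Isomorphic varieties. -/
def Isomorphic {k : Type*} [Field k] {X Y : Type*} (S : SpaceWithFunctions k X)
    (T : SpaceWithFunctions k Y) : Prop :=
  ∃ φ : X → Y, S.IsIsomorphism T φ

/-- The structure induced on `Y` by a map `j : Y → X`; for the inclusion of a locally closed
subset this is the reduced subvariety structure. Open sets are preimages of open sets, and regular
functions are those that locally extend to regular functions on open subsets of `X`. -/
def induced {k : Type*} [Field k] {X Y : Type*} (S : SpaceWithFunctions k X) (j : Y → X) :
    SpaceWithFunctions k Y where
  top := S.top.induced j
  IsRegular W f := ∀ y ∈ W, ∃ (O : Set X) (F : X → k), IsOpen[S.top] O ∧ j y ∈ O ∧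
    S.IsRegular O F ∧ ∀ z ∈ W, j z ∈ O → f z = F (j z)
  congr h hf y hy := by
    obtain ⟨O, F, hO, hyO, hF, hfF⟩ := hf y hy
    exact ⟨O, F, hO, hyO, hF, fun z hz hzO => (h z hz).symm.trans (hfF z hz hzO)⟩
  mono h hf y hy := by
    obtain ⟨O, F, hO, hyO, hF, hfF⟩ := hf y (h hy)
    exact ⟨O, F, hO, hyO, hF, fun z hz hzO => hfF z (h hz) hzO⟩
  glue h y hy := by
    obtain ⟨P, ⟨P', hP', rfl⟩, hyP, hf⟩ := h y hy
    obtain ⟨O, F, hO, hyO, hF, hfF⟩ := hf y ⟨hy, hyP⟩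
    exact ⟨O ∩ P', F, @IsOpen.inter _ S.top _ _ hO hP', ⟨hyO, hyP⟩,
      S.mono Set.inter_subset_left hF, fun z hz hzO => hfF z ⟨hz, hzO.2⟩ hzO.1⟩
  const W c y _ := ⟨Set.univ, fun _ => c, @isOpen_univ _ S.top, trivial, S.const _ c,
    fun _ _ _ => rfl⟩
  add hf hg y hy := by
    obtain ⟨O, F, hO, hyO, hF, hfF⟩ := hf y hy
    obtain ⟨P, G, hP, hyP, hG, hgG⟩ := hg y hy
    exact ⟨O ∩ P, F + G, @IsOpen.inter _ S.top _ _ hO hP, ⟨hyO, hyP⟩,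
      S.add (S.mono Set.inter_subset_left hF) (S.mono Set.inter_subset_right hG),
      fun z hz hzO => by simp [hfF z hz hzO.1, hgG z hz hzO.2]⟩
  mul hf hg y hy := by
    obtain ⟨O, F, hO, hyO, hF, hfF⟩ := hf y hy
    obtain ⟨P, G, hP, hyP, hG, hgG⟩ := hg y hy
    exact ⟨O ∩ P, F * G, @IsOpen.inter _ S.top _ _ hO hP, ⟨hyO, hyP⟩,
      S.mul (S.mono Set.inter_subset_left hF) (S.mono Set.inter_subset_right hG),
      fun z hz hzO => by simp [hfF z hz hzO.1, hgG z hz hzO.2]⟩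

/-- The final structure for a family of maps `π d : X d → Y`. For a single map this is the
quotient structure, for a family of quotient maps onto disjoint images that cover `Y` it is the
disjoint union of the quotients. -/
def coinduced {k : Type*} [Field k] {ι : Type*} {X : ι → Type*} {Y : Type*}
    (S : ∀ d, SpaceWithFunctions k (X d)) (π : ∀ d, X d → Y) : SpaceWithFunctions k Y where
  top := ⨆ d, (S d).top.coinduced (π d)
  IsRegular W f := ∀ d, (S d).IsRegular (π d ⁻¹' W) (f ∘ π d)
  congr h hf d := (S d).congr (fun x hx => h (π d x) hx) (hf d)
  mono h hf d := (S d).mono (fun _ hx => h hx) (hf d)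
  glue h d := (S d).glue fun x hx => by
    obtain ⟨O, hO, hxO, hf⟩ := h (π d x) hx
    exact ⟨π d ⁻¹' O, isOpen_coinduced.1 (isOpen_iSup_iff.1 hO d), hxO, hf d⟩
  const W c d := (S d).const _ c
  add hf hg d := (S d).add (hf d) (hg d)
  mul hf hg d := (S d).mul (hf d) (hg d)

end SpaceWithFunctions

/-- The algebra of polynomial functions on a `k`-vector space, generated by the linear forms. -/
def polyFunctions (k : Type*) [Field k] (V : Type*) [AddCommGroup V] [Module k V] :
    Subalgebra k (V → k) :=
  Algebra.adjoin k (Set.range fun (l : V →ₗ[k] k) => (l : V → k))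

/-- A vector space `V` as an affine space: the sets where a polynomial function does not vanish
form a basis of the Zariski topology, and the regular functions are locally quotients of
polynomial functions. For `V = Fin n → k` this is affine `n`-space. -/
def affineVariety (k : Type*) [Field k] (V : Type*) [AddCommGroup V] [Module k V] :
    SpaceWithFunctions k V where
  top := TopologicalSpace.generateFrom {D | ∃ h ∈ polyFunctions k V, D = {x | h x ≠ 0}}
  IsRegular W f := ∀ x ∈ W, ∃ g ∈ polyFunctions k V, ∃ h ∈ polyFunctions k V,
    h x ≠ 0 ∧ ∀ y ∈ W, h y ≠ 0 → f y = g y / h y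
  congr e hf x hx := by
    obtain ⟨g, hg, h, hh, hx0, H⟩ := hf x hx
    exact ⟨g, hg, h, hh, hx0, fun y hy hy0 => (e y hy).symm.trans (H y hy hy0)⟩
  mono e hf x hx := by
    obtain ⟨g, hg, h, hh, hx0, H⟩ := hf x (e hx)
    exact ⟨g, hg, h, hh, hx0, fun y hy hy0 => H y (e hy) hy0⟩
  glue {W f} e x hx := by
    obtain ⟨O, hO, hxO, hf⟩ := e x hx
    have key : ∀ O : Set V, TopologicalSpace.GenerateOpen
        {D | ∃ h ∈ polyFunctions k V, D = {x | h x ≠ 0}} O → ∀ x ∈ O,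
        ∃ p ∈ polyFunctions k V, p x ≠ 0 ∧ ∀ y, p y ≠ 0 → y ∈ O := by
      intro O hO
      induction hO with
      | basic s hs =>
        obtain ⟨h, hh, rfl⟩ := hs
        exact fun x hx => ⟨h, hh, hx, fun y hy => hy⟩
      | univ => exact fun x _ => ⟨1, one_mem _, by simp, fun _ _ => trivial⟩
      | inter s t _ _ hs ht =>
        intro x hx
        obtain ⟨p, hp, hpx, hps⟩ := hs x hx.1
        obtain ⟨r, hr, hrx, hrt⟩ := ht x hx.2
        refine ⟨p * r, mul_mem hp hr, mul_ne_zero hpx hrx, fun y hy => ⟨hps y ?_, hrt y ?_⟩⟩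
        · exact fun h0 => hy (by simp [h0])
        · exact fun h0 => hy (by simp [h0])
      | sUnion S _ hS =>
        rintro x ⟨s, hs, hxs⟩
        obtain ⟨p, hp, hpx, hps⟩ := hS s hs x hxs
        exact ⟨p, hp, hpx, fun y hy => ⟨s, hs, hps y hy⟩⟩
    obtain ⟨p, hp, hpx, hpO⟩ := key O hO x hxO
    obtain ⟨g, hg, h, hh, hx0, H⟩ := hf x ⟨hx, hxO⟩
    refine ⟨g * p, mul_mem hg hp, h * p, mul_mem hh hp, mul_ne_zero hx0 hpx, fun y hy hy0 => ?_⟩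
    have hy0' : h y * p y ≠ 0 := hy0
    have hpy : p y ≠ 0 := right_ne_zero_of_mul hy0'
    rw [H y ⟨hy, hpO y hpy⟩ (left_ne_zero_of_mul hy0')]
    exact (mul_div_mul_right _ _ hpy).symm
  const W c x _ := ⟨algebraMap k (V → k) c, Subalgebra.algebraMap_mem _ c, 1, one_mem _,
    by simp, fun y _ _ => by simp⟩
  add hf hg x hx := by
    obtain ⟨g, hg', h, hh, hx0, H⟩ := hf x hx
    obtain ⟨g', hg'', h', hh', hx0', H'⟩ := hg x hx
    refine ⟨g * h' + h * g', add_mem (mul_mem hg' hh') (mul_mem hh hg''), h * h',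
      mul_mem hh hh', mul_ne_zero hx0 hx0', fun y hy hy0 => ?_⟩
    have hy0' : h y * h' y ≠ 0 := hy0
    have h1 := left_ne_zero_of_mul hy0'
    have h2 := right_ne_zero_of_mul hy0'
    simp only [Pi.add_apply, Pi.mul_apply, H y hy h1, H' y hy h2]
    exact div_add_div _ _ h1 h2
  mul hf hg x hx := by
    obtain ⟨g, hg', h, hh, hx0, H⟩ := hf x hx
    obtain ⟨g', hg'', h', hh', hx0', H'⟩ := hg x hx
    refine ⟨g * g', mul_mem hg' hg'', h * h',
      mul_mem hh hh', mul_ne_zero hx0 hx0', fun y hy hy0 => ?_⟩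
    have hy0' : h y * h' y ≠ 0 := hy0
    have h1 := left_ne_zero_of_mul hy0'
    have h2 := right_ne_zero_of_mul hy0'
    simp only [Pi.mul_apply, H y hy h1, H' y hy h2]
    exact div_mul_div_comm _ _ _ _

/-! ### Quiver representations -/

/-- Representations over `k` of the quiver `Q`: functors from the path category of `Q` to vector
spaces. Finite dimensionality is stated separately where it is needed. -/
abbrev QuiverRep (k Q : Type u) [Field k] [Quiver.{u} Q] := Paths Q ⥤ ModuleCat.{u} k

instance (k Q : Type u) [Field k] [Quiver.{u} Q] : HasExt.{u + 1} (QuiverRep k Q) :=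
  HasExt.standard _

namespace QuiverRep

variable {k Q : Type u} [Field k] [Quiver.{u} Q]

/-- The vector space at the vertex `p`. -/
abbrev space (M : QuiverRep k Q) (p : Q) : ModuleCat.{u} k := M.obj ((Paths.of Q).obj p)

/-- The linear map of the arrow `a`. -/
def arrow (M : QuiverRep k Q) {p r : Q} (a : p ⟶ r) : M.space p →ₗ[k] M.space r :=
  (M.map ((Paths.of Q).map a)).hom

/-- The component at the vertex `p` of a morphism of representations. -/
def component {M N : QuiverRep k Q} (φ : M ⟶ N) (p : Q) : M.space p →ₗ[k] N.space p :=
  (φ.app ((Paths.of Q).obj p)).hom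

theorem component_arrow {M N : QuiverRep k Q} (φ : M ⟶ N) {p r : Q} (a : p ⟶ r)
    (x : M.space p) : component φ r (M.arrow a x) = N.arrow a (component φ p x) := by
  have h := φ.naturality ((Paths.of Q).map a)
  have h' := congrArg (fun t => t.hom x) h
  simpa [component, arrow] using h'

/-- The dimension vector, as an element of `ℤ Q₀`. -/
def dimVec (M : QuiverRep k Q) (p : Q) : ℤ := finrank k (M.space p)

/-- The representation with given spaces at the vertices and given linear maps at the arrows. -/
def ofArrows (V : Q → Type u) [∀ p, AddCommGroup (V p)] [∀ p, Module k (V p)]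
    (f : ∀ {p r : Q}, (p ⟶ r) → (V p →ₗ[k] V r)) : QuiverRep k Q :=
  Paths.lift { obj := fun p => ModuleCat.of k (V p), map := fun a => ModuleCat.ofHom (f a) }

/-- The simple representation `S_q`: the space at `p` is `k` if `p = q` and zero otherwise, and all
arrows act by zero. -/
def simple (k : Type u) {Q : Type u} [Field k] [Quiver.{u} Q] (q : Q) : QuiverRep k Q :=
  ofArrows (fun p => PLift (p = q) → k) (fun _ => 0)

/-! ### Subrepresentations -/

/-- A subrepresentation of `M`: subspaces that are stable under all arrows. -/
@[ext] structure SubRep (M : QuiverRep k Q) where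
  carrier : ∀ p : Q, Submodule k (M.space p)
  stable : ∀ {p r : Q} (a : p ⟶ r), ∀ x ∈ carrier p, M.arrow a x ∈ carrier r

namespace SubRep

/-- A subrepresentation as a representation. -/
def toRep {M : QuiverRep k Q} (U : SubRep M) : QuiverRep k Q :=
  ofArrows (fun p => U.carrier p) (fun a => (M.arrow a).restrict (U.stable a))

/-- The preimage `φ⁻¹(U)` of a subrepresentation. -/
def comap {M N : QuiverRep k Q} (φ : M ⟶ N) (U : SubRep N) : SubRep M where
  carrier p := (U.carrier p).comap (component φ p)
  stable a x hx := by
    rw [Submodule.mem_comap, component_arrow]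
    exact U.stable a _ hx

/-- The image `φ(U)` of a subrepresentation. -/
def map {M N : QuiverRep k Q} (φ : M ⟶ N) (U : SubRep M) : SubRep N where
  carrier p := (U.carrier p).map (component φ p)
  stable a x hx := by
    obtain ⟨y, hy, rfl⟩ := hx
    exact ⟨M.arrow a y, U.stable a y hy, component_arrow φ a y⟩

end SubRep

/-! ### Quiver Grassmannians -/

/-- Families `b` of bases `b p` of `d p`-dimensional subspaces of the spaces `M p`. This is an open
subset of the affine space of all families of vectors. -/
def Frame (M : QuiverRep k Q) (d : Q → ℕ) : Type u :=
  {b : ∀ p : Q, Fin (d p) → M.space p // ∀ p, LinearIndependent k (b p)}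

/-- The variety of frames, as a subvariety of the affine space of all families of vectors. -/
def frameVariety (M : QuiverRep k Q) (d : Q → ℕ) : SpaceWithFunctions k (Frame M d) :=
  (affineVariety k (∀ p : Q, Fin (d p) → M.space p)).induced Subtype.val

/-- The family of subspaces spanned by a frame. -/
def Frame.span {M : QuiverRep k Q} {d : Q → ℕ} (b : Frame M d) :
    ∀ p : Q, Submodule k (M.space p) :=
  fun p => Submodule.span k (Set.range (b.1 p))

/-- The set of all families of subspaces of the `M p` as the disjoint union over `d` of the
products `∏ p, Gr(d p, M p)` of usual Grassmannians. The product belonging to `d` is the quotient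
of the variety of frames by `∏ p, GL(d p)`. -/
def grassmannians (M : QuiverRep k Q) :
    SpaceWithFunctions k (∀ p : Q, Submodule k (M.space p)) :=
  SpaceWithFunctions.coinduced (fun d : Q → ℕ => frameVariety M d) (fun _ => Frame.span)

/-- The quiver Grassmannian `Gr_e(M)`: the subrepresentations of dimension vector `e`. It is empty
if `e` has a negative entry. -/
def gr (M : QuiverRep k Q) (e : Q → ℤ) : Set (SubRep M) :=
  {U | ∀ p, (finrank k (U.carrier p) : ℤ) = e p}

/-- The structure of a subvariety of the Grassmannians on a set of subrepresentations, in
particular on `Gr_e(M)` and its subvarieties. -/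
def subvariety {M : QuiverRep k Q} (Y : Set (SubRep M)) : SpaceWithFunctions k Y :=
  (grassmannians M).induced fun U => U.1.carrier

/-- The map `Ψ`, `U ↦ (i⁻¹(U), π(U))`. Its restriction to `Gr_e(B)` is `Ψ_e`; the disjoint union
of the `Gr_f(M) × Gr_g(N)` is regarded as a set of pairs of subrepresentations. -/
def psi {M B N : QuiverRep k Q} (i : M ⟶ B) (π : B ⟶ N) (U : SubRep B) : SubRep M × SubRep N :=
  (U.comap i, U.map π)

/-- For `i : M ⟶ B`, the set of `U` in `Gr_e(B)` that contain the image of `M`. -/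
def grContaining {M B : QuiverRep k Q} (i : M ⟶ B) (e : Q → ℤ) : Set (SubRep B) :=
  {U ∈ gr B e | ∀ p, LinearMap.range (component i p) ≤ U.carrier p}

/-- For `i : M ⟶ B`, the set of `U` in `Gr_e(B)` that meet the image of `M` in zero. -/
def grDisjoint {M B : QuiverRep k Q} (i : M ⟶ B) (e : Q → ℤ) : Set (SubRep B) :=
  {U ∈ gr B e | ∀ p, U.carrier p ⊓ LinearMap.range (component i p) = ⊥}

end QuiverRep

end

/-!
Let `K` be the image of `i`, which is the kernel of `π`. The subrepresentations of `B` that contain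
`K` correspond to those of `N` by `U ↦ π(U)` and `V ↦ π⁻¹(V)`. The subrepresentations `U` that meet
`K` in zero are mapped isomorphically to `V = π(U)` by `π`, so that the fibre over `V` consists of
the images of the lifts `s : V ⟶ B` of the inclusion `V ⟶ N` along `π`.

If `Ext¹(V, S_q) = 0`, then there is a lift `s₀` (`exists_lift_of_subsingleton_ext`), and the lifts
are the `s₀ + h ≫ i` with `h : V ⟶ S_q`. Conversely, a lift shows that the class `ξ` of the
extension `B` restricts to zero in `Ext¹(V, S_q)`. Now `ξ` generates `Ext¹(N, S_q)` over `End(S_q)` because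
`Ext¹(B, S_q) = 0`, and `Ext¹(N, S_q) ⟶ Ext¹(V, S_q)` is surjective because representations of
quivers are hereditary; hence `Ext¹(V, S_q) = 0` (`subsingleton_ext_of_lift`). The surjectivity
(`exists_ext_comp_eq`) comes from an explicit injective resolution of length one by coinduced
representations (`coind_shortExact`).

It remains to see that the maps are morphisms of varieties. The Grassmannians are covered by the
open charts of the families `U` that a given family of linear maps takes isomorphically onto
coordinate spaces. Over a chart, `U` has a distinguished basis, which depends regularly on `U` by
Cramer's rule (`regular_chartSection`). On the other hand, linearly independent vectors that depend
regularly on a parameter define a morphism to the Grassmannians (`isMorphism_span`). So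
`U ↦ π(U)` is a morphism where the dimension of `π(U)` is constant (`isMorphism_map`), as is
`V ↦ π⁻¹(V)` (`isMorphism_comap`). A fibre lies in a single chart, given by coordinates on `V`, and
the distinguished basis recovers `h` (`fibre_isomorphic_affine`).
-/

noncomputable section

/-! ### Morphisms of representations -/

namespace QuiverRep

variable {k Q : Type u} [Field k] [Quiver.{u} Q]

/-- The action of a path on a representation. -/
def path (M : QuiverRep k Q) {p r : Q} (c : Quiver.Path p r) : M.space p →ₗ[k] M.space r :=
  (M.map (X := (Paths.of Q).obj p) (Y := (Paths.of Q).obj r) c).hom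

theorem path_nil (M : QuiverRep k Q) (p : Q) (x : M.space p) :
    M.path (Quiver.Path.nil : Quiver.Path p p) x = x := by
  have h := M.map_id ((Paths.of Q).obj p)
  exact congrArg (fun t => t.hom x) h

theorem path_comp (M : QuiverRep k Q) {p r s : Q} (c : Quiver.Path p r) (c' : Quiver.Path r s)
    (x : M.space p) : M.path (c.comp c') x = M.path c' (M.path c x) := by
  have h := M.map_comp (X := (Paths.of Q).obj p) (Y := (Paths.of Q).obj r)
    (Z := (Paths.of Q).obj s) c c'
  exact congrArg (fun t => t.hom x) h

theorem path_cons (M : QuiverRep k Q) {p r s : Q} (c : Quiver.Path p r) (a : r ⟶ s)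
    (x : M.space p) : M.path (c.cons a) x = M.arrow a (M.path c x) :=
  path_comp M c a.toPath x

theorem component_path {M N : QuiverRep k Q} (φ : M ⟶ N) {p r : Q} (c : Quiver.Path p r)
    (x : M.space p) : component φ r (M.path c x) = N.path c (component φ p x) := by
  have h := φ.naturality (X := (Paths.of Q).obj p) (Y := (Paths.of Q).obj r) c
  exact congrArg (fun t => t.hom x) h

/-- A morphism of representations from linear maps at the vertices that commute with the arrows. -/
def homMk {M N : QuiverRep k Q} (f : ∀ p : Q, M.space p →ₗ[k] N.space p)
    (h : ∀ {p r : Q} (a : p ⟶ r) (x : M.space p), f r (M.arrow a x) = N.arrow a (f p x)) :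
    M ⟶ N where
  app p := ModuleCat.ofHom (f p)
  naturality {p r} c := by
    have key : ∀ {p r : Q} (c : Quiver.Path p r) (x : M.space p),
        f r (M.path c x) = N.path c (f p x) := by
      intro p r c x
      induction c with
      | nil => rw [path_nil, path_nil]
      | cons c a ih => rw [path_cons, path_cons, h, ih]
    ext x
    exact key (show Quiver.Path (V := Q) p r from c) x

theorem hom_ext {M N : QuiverRep k Q} {φ ψ : M ⟶ N}
    (h : ∀ (p : Q) (x : M.space p), component φ p x = component ψ p x) : φ = ψ := by
  ext p x
  exact h p x

theorem component_comp {M N L : QuiverRep k Q} (φ : M ⟶ N) (ψ : N ⟶ L) (p : Q) (x : M.space p) :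
    component (φ ≫ ψ) p x = component ψ p (component φ p x) := rfl

theorem component_add {M N : QuiverRep k Q} (φ ψ : M ⟶ N) (p : Q) (x : M.space p) :
    component (φ + ψ) p x = component φ p x + component ψ p x := rfl

theorem component_zero {M N : QuiverRep k Q} (p : Q) (x : M.space p) :
    component (0 : M ⟶ N) p x = 0 := rfl

theorem component_smul {M N : QuiverRep k Q} (c : k) (φ : M ⟶ N) (p : Q) (x : M.space p) :
    component (c • φ) p x = c • component φ p x := rfl

theorem ofArrows_arrow (V : Q → Type u) [∀ p, AddCommGroup (V p)] [∀ p, Module k (V p)]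
    (f : ∀ {p r : Q}, (p ⟶ r) → (V p →ₗ[k] V r)) {p r : Q} (a : p ⟶ r) (x : V p) :
    (ofArrows V f).arrow a x = f a x := by
  have h := Paths.lift_toPath
    { obj := fun p => ModuleCat.of k (V p), map := fun a => ModuleCat.ofHom (f a) } a
  exact congrArg (fun t => t.hom x) h

/-- The inclusion of a subrepresentation. -/
def SubRep.incl {M : QuiverRep k Q} (U : SubRep M) : U.toRep ⟶ M :=
  homMk (fun p => (U.carrier p).subtype) fun {p r} a x => by
    erw [ofArrows_arrow]

/-! ### Short exact sequences at the vertices -/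

theorem injective_component_of_mono {M N : QuiverRep k Q} (φ : M ⟶ N) [Mono φ] (p : Q) :
    Function.Injective (component φ p) :=
  (ModuleCat.mono_iff_injective _).1 (inferInstanceAs (Mono (φ.app ((Paths.of Q).obj p))))

theorem surjective_component_of_epi {M N : QuiverRep k Q} (φ : M ⟶ N) [Epi φ] (p : Q) :
    Function.Surjective (component φ p) :=
  (ModuleCat.epi_iff_surjective _).1 (inferInstanceAs (Epi (φ.app ((Paths.of Q).obj p))))

theorem mono_of_injective_component {M N : QuiverRep k Q} (φ : M ⟶ N)
    (h : ∀ p : Q, Function.Injective (component φ p)) : Mono φ := by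
  have : ∀ p, Mono (φ.app p) := fun p => (ModuleCat.mono_iff_injective _).2 (h p)
  exact NatTrans.mono_of_mono_app φ

theorem epi_of_surjective_component {M N : QuiverRep k Q} (φ : M ⟶ N)
    (h : ∀ p : Q, Function.Surjective (component φ p)) : Epi φ := by
  have : ∀ p, Epi (φ.app p) := fun p => (ModuleCat.epi_iff_surjective _).2 (h p)
  exact NatTrans.epi_of_epi_app φ

instance SubRep.mono_incl {M : QuiverRep k Q} (U : SubRep M) : Mono U.incl :=
  mono_of_injective_component _ fun _ => Subtype.val_injective

theorem range_component_eq_ker {S : ShortComplex (QuiverRep k Q)} (hS : S.ShortExact) (p : Q) :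
    LinearMap.range (component S.f p) = LinearMap.ker (component S.g p) :=
  (hS.map_of_exact ((evaluation (Paths Q) (ModuleCat.{u} k)).obj
    ((Paths.of Q).obj p))).exact.moduleCat_range_eq_ker

/-! ### Coinduced representations -/

section Coind

variable (W : Q → Type u) [∀ r, AddCommGroup (W r)] [∀ r, Module k (W r)]

/-- The families of vectors in the spaces `W r` indexed by the paths from `p`. -/
abbrev PathFamily (p : Q) : Type u := ∀ r : Q, Quiver.Path p r → W r

/-- The representation coinduced from a family of vector spaces `W r`: the space at `p` consists of
the families of vectors in `W r` indexed by the paths from `p` to `r`. It is the product of the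
injective representations attached to the vertices `r`. -/
def coind : QuiverRep k Q where
  obj p := ModuleCat.of k (PathFamily W p)
  map {p p'} f := ModuleCat.ofHom
    { toFun := fun (φ : PathFamily W p) r c => φ r (Quiver.Path.comp (V := Q) f c)
      map_add' := fun _ _ => rfl
      map_smul' := fun _ _ => rfl }
  map_id p := by
    ext (φ : PathFamily W p)
    exact congrArg (φ _) (Quiver.Path.nil_comp (V := Q) _)
  map_comp f g := by
    ext (φ : PathFamily W _)
    exact congrArg (φ _) (Quiver.Path.comp_assoc (V := Q) f g _)

variable {W}

theorem coind_ext {p : Q} {φ ψ : (coind W : QuiverRep k Q).space p}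
    (h : ∀ (r : Q) (c : Quiver.Path p r), (φ : PathFamily W p) r c = (ψ : PathFamily W p) r c) :
    φ = ψ :=
  funext fun r => funext fun c => h r c

/-- The morphism to a coinduced representation that belongs to a family of linear maps. -/
def coindHom {M : QuiverRep k Q} (θ : ∀ r : Q, M.space r →ₗ[k] W r) : M ⟶ coind W :=
  homMk (fun p =>
    { toFun := fun m => show PathFamily W p from fun r c => θ r (M.path c m)
      map_add' := fun x y => coind_ext fun r c => by
        change θ r (M.path c (x + y)) = θ r (M.path c x) + θ r (M.path c y)
        rw [map_add, map_add]
      map_smul' := fun t x => coind_ext fun r c => by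
        change θ r (M.path c (t • x)) = t • θ r (M.path c x)
        rw [map_smul, map_smul] })
    fun {p r} a x => by
      refine coind_ext fun s c => ?_
      exact congrArg (θ s) (path_comp M a.toPath c x).symm

/-- The linear maps that belong to a morphism to a coinduced representation: evaluation at the
trivial paths. -/
def coindEval {M : QuiverRep k Q} (g : M ⟶ coind W) (r : Q) : M.space r →ₗ[k] W r :=
  (LinearMap.proj (R := k) (φ := fun _ : Quiver.Path r r => W r) Quiver.Path.nil).comp
    ((LinearMap.proj (R := k) (φ := fun s => Quiver.Path r s → W s) r).comp (component g r))

theorem coindHom_coindEval {M : QuiverRep k Q} (g : M ⟶ coind W) :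
    coindHom (coindEval g) = g := by
  refine hom_ext fun p x => coind_ext fun r c => ?_
  have h := congrArg (fun φ : PathFamily W r => φ r Quiver.Path.nil) (component_path g c x)
  exact h.trans (congrArg ((component g p x : PathFamily W p) r) (Quiver.Path.comp_nil c))

/-- Morphisms to a coinduced representation are families of linear maps at the vertices, and these
extend along inclusions of vector spaces. -/
instance : Injective (coind W : QuiverRep k Q) where
  factors {X Y} g f _ := by
    have h : ∀ r : Q, ∃ ρ : Y.space r →ₗ[k] X.space r, ρ.comp (component f r) = LinearMap.id :=
      fun r => (component f r).exists_leftInverse_of_injective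
        (LinearMap.ker_eq_bot.2 (injective_component_of_mono f r))
    choose ρ hρ using h
    refine ⟨coindHom fun r => (coindEval g r).comp (ρ r), ?_⟩
    conv_rhs => rw [← coindHom_coindEval g]
    refine hom_ext fun p x => coind_ext fun r c => ?_
    have h := LinearMap.congr_fun (hρ r) (X.path c x)
    rw [LinearMap.comp_apply, component_path] at h
    exact congrArg (coindEval g r) h

end Coind

section Resolution

variable (M : QuiverRep k Q)

/-- The embedding of a representation into the representation coinduced from its spaces. -/
def toCoind : M ⟶ coind (fun r : Q => M.space r) :=
  coindHom fun _ => LinearMap.id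

/-- The second map of the standard injective resolution of `M`: a family `φ` is sent to the family
of its defects `M a (φ c) - φ (c a)` along the arrows. -/
def coindDefect : coind (fun r : Q => M.space r) ⟶
    coind (k := k) (fun r : Q => ∀ r' : Q, (r ⟶ r') → M.space r') :=
  homMk (fun p =>
    { toFun := fun (φ : PathFamily (fun r : Q => M.space r) p) =>
        show PathFamily (fun r : Q => ∀ r' : Q, (r ⟶ r') → M.space r') p from
          fun r c r' a => M.arrow a (φ r c) - φ r' (c.cons a)
      map_add' := fun x y => coind_ext fun r c => by
        funext r' a
        change M.arrow a (x r c + y r c) - (x r' (c.cons a) + y r' (c.cons a)) = _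
        rw [map_add, add_sub_add_comm]
        rfl
      map_smul' := fun t x => coind_ext fun r c => by
        funext r' a
        change M.arrow a (t • x r c) - t • x r' (c.cons a) = _
        rw [map_smul, ← smul_sub]
        rfl })
    fun _ _ => rfl

theorem toCoind_comp_coindDefect : M.toCoind ≫ M.coindDefect = 0 := by
  refine hom_ext fun p x => coind_ext fun r c => funext fun r' => funext fun a => ?_
  exact sub_eq_zero.2 (path_cons M c a x).symm

/-- A family of vectors along the paths from `p` with prescribed defects, by recursion on the
path. -/
def solveDefect {p : Q} (ψ : ∀ r : Q, Quiver.Path p r → ∀ r' : Q, (r ⟶ r') → M.space r') :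
    ∀ {r : Q}, Quiver.Path p r → M.space r
  | _, Quiver.Path.nil => 0
  | _, Quiver.Path.cons c a => M.arrow a (solveDefect ψ c) - ψ _ c _ a

/-- The sequence `0 ⟶ M ⟶ coind ⟶ coind ⟶ 0` is exact: a family without defects is determined by
its vector at the trivial path, and every family of defects is attained by `solveDefect`. -/
theorem coind_shortExact :
    (ShortComplex.mk M.toCoind M.coindDefect M.toCoind_comp_coindDefect).ShortExact := by
  have hmono : Mono M.toCoind := mono_of_injective_component _ fun p x y h => by
    have h' := congrFun (congrFun h p) Quiver.Path.nil
    change M.path Quiver.Path.nil x = M.path Quiver.Path.nil y at h'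
    rwa [path_nil, path_nil] at h'
  have hepi : Epi M.coindDefect := epi_of_surjective_component _ fun p ψ => by
    refine ⟨show PathFamily (fun r : Q => M.space r) p from fun r c => M.solveDefect ψ c,
      coind_ext fun r c => funext fun r' => funext fun a => ?_⟩
    exact sub_sub_cancel _ _
  refine { exact := ShortComplex.exact_of_f_is_kernel _ ?_, mono_f := hmono, epi_g := hepi }
  refine Limits.KernelFork.IsLimit.ofι' _ _ fun {T} t ht => ⟨homMk (coindEval t) ?_, ?_⟩
  · intro p r a x
    have h1 := congrFun (congrFun (congrFun (congrFun
      (congrArg (fun g => component g p x) ht) p) Quiver.Path.nil) r) a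
    have h2 := sub_eq_zero.1 h1
    have h3 : (component t r (T.arrow a x) : ∀ s : Q, Quiver.Path r s → M.space s) r
        Quiver.Path.nil =
        (component t p x : ∀ s : Q, Quiver.Path p s → M.space s) r a.toPath := by
      rw [component_arrow]
      rfl
    exact h3.trans h2.symm
  · conv_rhs => rw [← coindHom_coindEval t]
    refine hom_ext fun p x => coind_ext fun r c => ?_
    have h := component_path (homMk (M := T) (N := M) (coindEval t) ?_) c x
    exact h.symm

end Resolution

end QuiverRep

/-! ### Extensions and restriction to subrepresentations -/

namespace QuiverRep

variable {k Q : Type u} [Field k] [Quiver.{u} Q]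

open Abelian in
/-- Representations of quivers are hereditary: restriction to a subrepresentation is surjective
on `Ext¹`. Indeed, classes in `Ext¹` come from morphisms to the last term of the standard injective
resolution, which is injective. -/
theorem exists_ext_comp_eq {V N : QuiverRep k Q} (M : QuiverRep k Q) (ι : V ⟶ N) [Mono ι]
    (x : Ext V M 1) : ∃ y : Ext N M 1, (Ext.mk₀ ι).comp y (zero_add 1) = x := by
  obtain ⟨g, rfl⟩ := Ext.covariant_sequence_exact₁ V M.coind_shortExact x
    (Ext.eq_zero_of_injective _) (zero_add 1)
  obtain ⟨g, rfl⟩ := (Ext.mk₀_bijective _ _).2 g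
  have hι : ι ≫ Injective.factorThru g ι = g := Injective.comp_factorThru g ι
  refine ⟨(Ext.mk₀ (Injective.factorThru g ι)).comp M.coind_shortExact.extClass (zero_add 1), ?_⟩
  rw [← Ext.comp_assoc _ _ _ (zero_add 0) (zero_add 1) (by lia), Ext.mk₀_comp_mk₀, hι]

variable {S B N V : QuiverRep k Q} {i : S ⟶ B} {π : B ⟶ N} {w : i ≫ π = 0}

open Abelian in
theorem exists_lift_of_subsingleton_ext (exact : (ShortComplex.mk i π w).ShortExact) (ι : V ⟶ N)
    (h : Subsingleton (Ext V S 1)) : ∃ s : V ⟶ B, s ≫ π = ι := by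
  obtain ⟨s, hs⟩ := Ext.covariant_sequence_exact₃ V exact (Ext.mk₀ ι) (zero_add 1)
    (Subsingleton.elim (α := Ext V S 1) _ _)
  obtain ⟨s, rfl⟩ := (Ext.mk₀_bijective _ _).2 s
  refine ⟨s, (Ext.mk₀_bijective _ _).1 ?_⟩
  rw [← hs]
  exact (Ext.mk₀_comp_mk₀ _ _).symm

open Abelian in
/-- If the inclusion of a subrepresentation `V` of `N` lifts to `B`, then it pulls the class of the
extension `B` back to zero. As `Ext¹(B, S) = 0`, this class generates `Ext¹(N, S)` over the
endomorphisms of `S`, and `Ext¹(N, S)` maps onto `Ext¹(V, S)`. -/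
theorem subsingleton_ext_of_lift (exact : (ShortComplex.mk i π w).ShortExact)
    (hB : Subsingleton (Ext B S 1)) (s : V ⟶ B) [Mono (s ≫ π)] :
    Subsingleton (Ext V S 1) := by
  refine subsingleton_of_forall_eq 0 fun x => ?_
  obtain ⟨y, rfl⟩ := exists_ext_comp_eq S (s ≫ π) x
  obtain ⟨φ, rfl⟩ := Ext.contravariant_sequence_exact₃ exact S y
    (Subsingleton.elim (α := Ext B S 1) _ _) (add_zero 1)
  rw [← Ext.mk₀_comp_mk₀_assoc]
  have h := exact.comp_extClass_assoc φ (add_zero 1)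
  exact (congrArg (fun z => (Ext.mk₀ s).comp z (zero_add 1)) h).trans (Ext.comp_zero _ _ _ _ _)

end QuiverRep

/-! ### Local spaces with functions -/

namespace SpaceWithFunctions

variable {k : Type*} [Field k] {X Y Z : Type*}

/-- The functions that are regular on `W` form a subalgebra. -/
def regularFunctions (S : SpaceWithFunctions k X) (W : Set X) : Subalgebra k (X → k) where
  carrier := {f | S.IsRegular W f}
  mul_mem' := S.mul
  add_mem' := S.add
  algebraMap_mem' := S.const W

/-- The property of varieties that the non-vanishing locus of a regular function is open and that
the function is invertible there. -/
def IsLocal (S : SpaceWithFunctions k X) : Prop :=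
  ∀ (W : Set X) (f : X → k), IsOpen[S.top] W → S.IsRegular W f →
    IsOpen[S.top] {x ∈ W | f x ≠ 0} ∧ S.IsRegular {x ∈ W | f x ≠ 0} f⁻¹

theorem isOpen_of_forall_exists (S : SpaceWithFunctions k X) {W : Set X}
    (h : ∀ x ∈ W, ∃ O : Set X, IsOpen[S.top] O ∧ x ∈ O ∧ O ⊆ W) : IsOpen[S.top] W := by
  let := S.top
  refine isOpen_iff_forall_mem_open.2 fun x hx => ?_
  obtain ⟨O, hO, hx, hs⟩ := h x hx
  exact ⟨O, hs, hO, hx⟩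

theorem IsLocal.induced {S : SpaceWithFunctions k X} (hS : S.IsLocal) (j : Y → X) :
    (S.induced j).IsLocal := by
  rintro W f ⟨W', hW', rfl⟩ hf
  have key : ∀ y ∈ j ⁻¹' W', f y ≠ 0 → ∃ (O : Set X) (F : X → k), IsOpen[S.top] O ∧ j y ∈ O ∧
      O ⊆ W' ∧ S.IsRegular O F ∧ (∀ x ∈ O, F x ≠ 0) ∧ ∀ z, j z ∈ O → f z = F (j z) := by
    intro y hy hy0
    obtain ⟨O, F, hO, hyO, hF, hfF⟩ := hf y hy
    have hOW := @IsOpen.inter _ S.top _ _ hO hW'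
    obtain ⟨h1, h2⟩ := hS (O ∩ W') F hOW (S.mono Set.inter_subset_left hF)
    refine ⟨_, F, h1, ⟨⟨hyO, hy⟩, ?_⟩, fun x hx => hx.1.2, S.mono (fun x hx => hx.1.1) hF,
      fun x hx => hx.2, fun z hz => hfF z hz.1.2 hz.1.1⟩
    rwa [← hfF y hy hyO]
  constructor
  · refine (S.induced j).isOpen_of_forall_exists fun y hy => ?_
    obtain ⟨O, F, hO, hyO, hOW, hF, hF0, hfF⟩ := key y hy.1 hy.2
    refine ⟨j ⁻¹' O, ⟨O, hO, rfl⟩, hyO, fun z hz => ⟨hOW hz, ?_⟩⟩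
    rw [hfF z hz]
    exact hF0 _ hz
  · rintro y hy
    obtain ⟨O, F, hO, hyO, hOW, hF, hF0, hfF⟩ := key y hy.1 hy.2
    refine ⟨O, F⁻¹, hO, hyO, S.mono (W := {x ∈ O | F x ≠ 0}) (fun x hx => ⟨hx, hF0 x hx⟩)
      (hS O F hO hF).2,
      fun z _ hz => ?_⟩
    rw [Pi.inv_apply, Pi.inv_apply, hfF z hz]

theorem IsLocal.coinduced {ι : Type*} {X : ι → Type*} {S : ∀ d, SpaceWithFunctions k (X d)}
    (hS : ∀ d, (S d).IsLocal) (π : ∀ d, X d → Y) : (coinduced S π).IsLocal := by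
  intro W f hW hf
  have hW' : ∀ d, IsOpen[(S d).top] (π d ⁻¹' W) := fun d =>
    isOpen_coinduced.1 (isOpen_iSup_iff.1 hW d)
  refine ⟨isOpen_iSup_iff.2 fun d => isOpen_coinduced.2 (hS d _ _ (hW' d) (hf d)).1,
    fun d => (hS d _ _ (hW' d) (hf d)).2⟩

/-! ### Morphisms -/

variable {S : SpaceWithFunctions k X} {T : SpaceWithFunctions k Y} {R : SpaceWithFunctions k Z}

theorem IsMorphism.comp {ψ : Y → Z} {φ : X → Y} (hψ : T.IsMorphism R ψ) (hφ : S.IsMorphism T φ) :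
    S.IsMorphism R (ψ ∘ φ) :=
  ⟨fun W hW => hφ.1 _ (hψ.1 W hW), fun W f hW hf => hφ.2 _ _ (hψ.1 W hW) (hψ.2 W f hW hf)⟩

theorem isMorphism_induced (S : SpaceWithFunctions k X) (j : Y → X) :
    (S.induced j).IsMorphism S j :=
  ⟨fun W hW => ⟨W, hW, rfl⟩, fun W f hW hf _ hy => ⟨W, f, hW, hy, hf, fun _ _ _ => rfl⟩⟩

theorem IsMorphism.to_induced {j : Z → Y} {φ : X → Z} (h : S.IsMorphism T (j ∘ φ)) :
    S.IsMorphism (T.induced j) φ := by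
  constructor
  · rintro _ ⟨W, hW, rfl⟩
    exact h.1 W hW
  · rintro _ f ⟨W, hW, rfl⟩ hf
    refine S.glue fun x hx => ?_
    obtain ⟨O, F, hO, hyO, hF, hfF⟩ := hf (φ x) hx
    exact ⟨_, h.1 O hO, hyO, S.congr (fun z hz => (hfF (φ z) hz.1 hz.2).symm)
      (S.mono Set.inter_subset_right (h.2 O F hO hF))⟩

theorem isMorphism_coinduced {ι : Type*} {X : ι → Type*} (S : ∀ d, SpaceWithFunctions k (X d))
    (π : ∀ d, X d → Y) (d : ι) : (S d).IsMorphism (coinduced S π) (π d) :=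
  ⟨fun _ hW => isOpen_coinduced.1 (isOpen_iSup_iff.1 hW d), fun _ _ _ hf => hf d⟩

/-- Being a morphism is local on the source. -/
theorem isMorphism_of_forall_exists {φ : X → Y}
    (h : ∀ x : X, ∃ O : Set X, IsOpen[S.top] O ∧ x ∈ O ∧
      (S.induced (Subtype.val : O → X)).IsMorphism T (fun z => φ z.1)) : S.IsMorphism T φ := by
  constructor
  · intro W hW
    refine S.isOpen_of_forall_exists fun x hx => ?_
    obtain ⟨O, hO, hxO, hφ⟩ := h x
    obtain ⟨P, hP, hPW⟩ := hφ.1 W hW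
    refine ⟨O ∩ P, @IsOpen.inter _ S.top _ _ hO hP, ⟨hxO, ?_⟩, ?_⟩
    · exact (Set.ext_iff.1 hPW ⟨x, hxO⟩).2 hx
    · exact fun z hz => (Set.ext_iff.1 hPW ⟨z, hz.1⟩).1 hz.2
  · intro W f hW hf
    refine S.glue fun x hx => ?_
    obtain ⟨O, hO, hxO, hφ⟩ := h x
    obtain ⟨P, F, hP, hxP, hF, hfF⟩ := hφ.2 W f hW hf ⟨x, hxO⟩ hx
    exact ⟨O ∩ P, @IsOpen.inter _ S.top _ _ hO hP, ⟨hxO, hxP⟩,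
      S.congr (fun z hz => (hfF ⟨z, hz.2.1⟩ hz.1 hz.2.2).symm)
        (S.mono (fun z hz => hz.2.2) hF)⟩

theorem IsMorphism.regular_comp {φ : X → Y} (hφ : S.IsMorphism T φ) {O : Set Y} {F : Y → k}
    (hO : IsOpen[T.top] O) (hF : T.IsRegular O F) (h : ∀ x, φ x ∈ O) :
    S.IsRegular Set.univ (fun x => F (φ x)) :=
  S.mono (fun x _ => h x) (hφ.2 O F hO hF)

theorem IsMorphism.regular_comp_univ {φ : X → Y} (hφ : S.IsMorphism T φ) {F : Y → k}
    (hF : T.IsRegular Set.univ F) : S.IsRegular Set.univ (fun x => F (φ x)) :=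
  hφ.regular_comp (@isOpen_univ _ T.top) hF fun _ => trivial

/-! ### Matrices of regular functions -/

theorem regular_sum {ι : Type*} {s : Finset ι} {W : Set X} {f : ι → X → k}
    (h : ∀ i ∈ s, S.IsRegular W (f i)) : S.IsRegular W (fun x => ∑ i ∈ s, f i x) := by
  have := sum_mem (S := S.regularFunctions W) h
  refine S.congr (fun x _ => ?_) this
  simp

theorem regular_det {n : Type*} [Fintype n] [DecidableEq n] {W : Set X}
    {A : X → Matrix n n k} (h : ∀ i j, S.IsRegular W (fun x => A x i j)) :
    S.IsRegular W (fun x => (A x).det) := by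
  have := sum_mem (S := S.regularFunctions W) (t := Finset.univ)
    (f := fun (σ : Equiv.Perm n) => (fun _ => ((Equiv.Perm.sign σ : ℤ) : k)) *
      ∏ i, (fun x => A x (σ i) i)) fun σ _ =>
    mul_mem (S.const W _) (prod_mem fun i _ => h (σ i) i)
  refine S.congr (fun x _ => ?_) this
  simp [Matrix.det_apply, Units.smul_def]

theorem regular_adjugate {n : Type*} [Fintype n] [DecidableEq n] {W : Set X}
    {A : X → Matrix n n k} (h : ∀ i j, S.IsRegular W (fun x => A x i j)) (i j : n) :
    S.IsRegular W (fun x => (A x).adjugate i j) := by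
  simp only [Matrix.adjugate_apply]
  refine regular_det fun i' j' => ?_
  by_cases hi : i' = j
  · subst hi
    simpa using S.const W _
  · simpa [Matrix.updateRow_ne hi] using h i' j'

/-- The entries of the inverse of a matrix of regular functions are regular where the matrix is
invertible. -/
theorem IsLocal.regular_inv (hS : S.IsLocal) {n : Type*} [Fintype n] [DecidableEq n] {W : Set X}
    (hW : IsOpen[S.top] W) {A : X → Matrix n n k}
    (h : ∀ i j, S.IsRegular W (fun x => A x i j)) (i j : n) :
    S.IsRegular {x ∈ W | (A x).det ≠ 0} (fun x => (A x)⁻¹ i j) := by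
  have h1 := (hS W _ hW (regular_det h)).2
  have h2 := S.mono (W' := {x ∈ W | (A x).det ≠ 0}) (fun x hx => hx.1) (regular_adjugate h i j)
  refine S.congr (fun x _ => ?_) (S.mul h1 h2)
  simp [Matrix.inv_def]

end SpaceWithFunctions

/-! ### Affine spaces -/

section Affine

open SpaceWithFunctions

variable {k : Type*} [Field k] {V : Type*} [AddCommGroup V] [Module k V]

theorem affineVariety_isOpen_ne_zero {h : V → k} (hh : h ∈ polyFunctions k V) :
    IsOpen[(affineVariety k V).top] {x | h x ≠ 0} :=
  TopologicalSpace.isOpen_generateFrom_of_mem ⟨h, hh, rfl⟩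

theorem affineVariety_regular_of_mem {h : V → k} (hh : h ∈ polyFunctions k V) (W : Set V) :
    (affineVariety k V).IsRegular W h := fun x _ =>
  ⟨h, hh, 1, one_mem _, one_ne_zero, fun y _ _ => by simp⟩

theorem affineVariety_regular_linear (l : V →ₗ[k] k) (W : Set V) :
    (affineVariety k V).IsRegular W l :=
  affineVariety_regular_of_mem (Algebra.subset_adjoin ⟨l, rfl⟩) W

/-- The principal open sets form a basis, and not only a subbasis, of the Zariski topology. -/
theorem exists_polyFunction_of_isOpen {O : Set V} (hO : IsOpen[(affineVariety k V).top] O)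
    {x : V} (hx : x ∈ O) :
    ∃ p ∈ polyFunctions k V, p x ≠ 0 ∧ ∀ y, p y ≠ 0 → y ∈ O := by
  change TopologicalSpace.GenerateOpen
    {D | ∃ h ∈ polyFunctions k V, D = {x | h x ≠ 0}} O at hO
  induction hO with
  | basic s hs =>
    obtain ⟨h, hh, rfl⟩ := hs
    exact ⟨h, hh, hx, fun y hy => hy⟩
  | univ => exact ⟨1, one_mem _, by simp, fun _ _ => trivial⟩
  | inter s t _ _ hs ht =>
    obtain ⟨p, hp, hpx, hps⟩ := hs hx.1
    obtain ⟨r, hr, hrx, hrt⟩ := ht hx.2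
    exact ⟨p * r, mul_mem hp hr, mul_ne_zero hpx hrx, fun y hy =>
      ⟨hps y (left_ne_zero_of_mul hy), hrt y (right_ne_zero_of_mul hy)⟩⟩
  | sUnion S _ hS =>
    obtain ⟨s, hs, hxs⟩ := hx
    obtain ⟨p, hp, hpx, hps⟩ := hS s hs hxs
    exact ⟨p, hp, hpx, fun y hy => ⟨s, hs, hps y hy⟩⟩

theorem affineVariety_isLocal (k : Type*) [Field k] (V : Type*) [AddCommGroup V] [Module k V] :
    (affineVariety k V).IsLocal := by
  intro W f hW hf
  constructor
  · refine (affineVariety k V).isOpen_of_forall_exists fun x hx => ?_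
    obtain ⟨g, hg, h, hh, hx0, H⟩ := hf x hx.1
    obtain ⟨p, hp, hpx, hpW⟩ := exists_polyFunction_of_isOpen hW hx.1
    have hgx : g x ≠ 0 := fun h0 => hx.2 (by rw [H x hx.1 hx0, h0, zero_div])
    refine ⟨{x | (g * h * p) x ≠ 0}, affineVariety_isOpen_ne_zero (mul_mem (mul_mem hg hh) hp),
      mul_ne_zero (mul_ne_zero hgx hx0) hpx, fun y hy => ?_⟩
    have hy1 := left_ne_zero_of_mul hy
    have hyW := hpW y (right_ne_zero_of_mul hy)
    refine ⟨hyW, ?_⟩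
    rw [H y hyW (right_ne_zero_of_mul hy1)]
    exact div_ne_zero (left_ne_zero_of_mul hy1) (right_ne_zero_of_mul hy1)
  · intro x hx
    obtain ⟨g, hg, h, hh, hx0, H⟩ := hf x hx.1
    have hgx : g x ≠ 0 := fun h0 => hx.2 (by rw [H x hx.1 hx0, h0, zero_div])
    -- The factor `h` of the denominator `g * h` excludes the points where `f` need not be `g / h`.
    refine ⟨h * h, mul_mem hh hh, g * h, mul_mem hg hh, mul_ne_zero hgx hx0, fun y hy hy0 => ?_⟩
    have hy1 := right_ne_zero_of_mul hy0
    rw [Pi.inv_apply, H y hy.1 hy1, inv_div]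
    exact (mul_div_mul_right _ _ hy1).symm

variable {X : Type*} {S : SpaceWithFunctions k X}

/-- A map to an affine space is a morphism if its coordinates are regular functions. -/
theorem SpaceWithFunctions.IsLocal.isMorphism_affine (hS : S.IsLocal) {φ : X → V}
    (h : ∀ l : V →ₗ[k] k, S.IsRegular Set.univ (fun x => l (φ x))) :
    S.IsMorphism (affineVariety k V) φ := by
  have hpoly : ∀ p ∈ polyFunctions k V, S.IsRegular Set.univ (fun x => p (φ x)) := by
    intro p hp
    induction hp using Algebra.adjoin_induction with
    | mem p hp =>
      obtain ⟨l, rfl⟩ := hp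
      exact h l
    | algebraMap c => exact S.const _ c
    | add p r _ _ hp hr => exact S.add hp hr
    | mul p r _ _ hp hr => exact S.mul hp hr
  have hu := @isOpen_univ _ S.top
  have hopen : ∀ p ∈ polyFunctions k V, IsOpen[S.top] {x | p (φ x) ≠ 0} ∧
      S.IsRegular {x | p (φ x) ≠ 0} (fun x => p (φ x))⁻¹ := fun p hp => by
    simpa using hS Set.univ _ hu (hpoly p hp)
  constructor
  · intro W hW
    refine S.isOpen_of_forall_exists fun x hx => ?_
    obtain ⟨p, hp, hpx, hpW⟩ := exists_polyFunction_of_isOpen hW hx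
    exact ⟨_, (hopen p hp).1, hpx, fun y hy => hpW _ hy⟩
  · intro W f hW hf
    refine S.glue fun x hx => ?_
    obtain ⟨g, hg, p, hp, hx0, H⟩ := hf (φ x) hx
    refine ⟨_, (hopen p hp).1, hx0, ?_⟩
    refine S.congr (fun y hy => ?_) (S.mul (S.mono (Set.subset_univ _) (hpoly g hg))
      (S.mono Set.inter_subset_right (hopen p hp).2))
    rw [Function.comp_apply, H _ hy.1 hy.2, div_eq_mul_inv]
    rfl

theorem SpaceWithFunctions.IsLocal.isMorphism_affine_pi (hS : S.IsLocal) {Q : Type*} [Finite Q]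
    {J : Q → Type*} [∀ p, Finite (J p)] {M : Q → Type*} [∀ p, AddCommGroup (M p)]
    [∀ p, Module k (M p)] {φ : X → ∀ p, J p → M p}
    (h : ∀ p (j : J p) (l : M p →ₗ[k] k), S.IsRegular Set.univ (fun x => l (φ x p j))) :
    S.IsMorphism (affineVariety k (∀ p, J p → M p)) φ := by
  classical
  have := Fintype.ofFinite Q
  have := fun p => Fintype.ofFinite (J p)
  refine hS.isMorphism_affine fun l => ?_
  have hl : ∀ b : ∀ p, J p → M p, l b = ∑ p, ∑ j,
      (l.comp ((LinearMap.single k (fun p => J p → M p) p).comp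
        (LinearMap.single k (fun _ => M p) j))) (b p j) := by
    intro b
    conv_lhs => rw [← Finset.univ_sum_single b]
    rw [map_sum]
    refine Finset.sum_congr rfl fun p _ => ?_
    conv_lhs => rw [← Finset.univ_sum_single (b p)]
    rw [← LinearMap.single_apply (R := k) (φ := fun p => J p → M p), map_sum, map_sum]
    rfl
  simp only [hl]
  exact regular_sum fun p _ => regular_sum fun j _ => h p j _

end Affine

/-! ### Charts of the Grassmannians -/

namespace QuiverRep

open SpaceWithFunctions

variable {k Q : Type u} [Field k] [Quiver.{u} Q]

theorem frameVariety_isLocal (M : QuiverRep k Q) (d : Q → ℕ) : (frameVariety M d).IsLocal :=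
  (affineVariety_isLocal k _).induced _

theorem grassmannians_isLocal (M : QuiverRep k Q) : (grassmannians M).IsLocal :=
  IsLocal.coinduced (fun d => frameVariety_isLocal M d) _

theorem subvariety_isLocal {M : QuiverRep k Q} (Y : Set (SubRep M)) : (subvariety Y).IsLocal :=
  (grassmannians_isLocal M).induced _

theorem Frame.finrank_span {M : QuiverRep k Q} {d : Q → ℕ} (b : Frame M d) (p : Q) :
    finrank k (b.span p) = d p :=
  (finrank_span_eq_card (b.2 p)).trans (Fintype.card_fin _)

theorem frameVariety_regular_coord {M : QuiverRep k Q} {d : Q → ℕ} (W : Set (Frame M d)) (p : Q)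
    (j : Fin (d p)) (l : M.space p →ₗ[k] k) :
    (frameVariety M d).IsRegular W (fun b => l (b.1 p j)) := by
  refine (frameVariety M d).mono (Set.subset_univ W) ?_
  exact (isMorphism_induced _ _).regular_comp_univ (affineVariety_regular_linear
    (l.comp ((LinearMap.proj (R := k) (φ := fun _ : Fin (d p) => M.space p) j).comp
      (LinearMap.proj (R := k) (φ := fun p => Fin (d p) → M.space p) p))) _)

/-- The span of a family of linearly independent vectors that depend regularly on a point of a
variety is a morphism to the Grassmannians. -/
theorem isMorphism_span [Finite Q] {X : Type*} {S : SpaceWithFunctions k X} (hS : S.IsLocal)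
    (M : QuiverRep k Q) {J : Q → Type*} [∀ p, Finite (J p)] (F : X → ∀ p : Q, J p → M.space p)
    (hF : ∀ x p, LinearIndependent k (F x p))
    (hreg : ∀ (p : Q) (j : J p) (l : M.space p →ₗ[k] k),
      S.IsRegular Set.univ (fun x => l (F x p j))) :
    S.IsMorphism (grassmannians M) (fun x p => Submodule.span k (Set.range (F x p))) := by
  let d : Q → ℕ := fun p => Nat.card (J p)
  let e : ∀ p, Fin (d p) ≃ J p := fun p => (Finite.equivFin (J p)).symm
  let b : X → Frame M d := fun x => ⟨fun p => F x p ∘ e p, fun p =>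
    (hF x p).comp _ (e p).injective⟩
  have hb : S.IsMorphism (frameVariety M d) b := by
    refine IsMorphism.to_induced ?_
    exact hS.isMorphism_affine_pi fun p j l => hreg p (e p j) l
  have h := (isMorphism_coinduced (fun d : Q → ℕ => frameVariety M d)
    (fun _ => Frame.span) d).comp hb
  have heq : (fun x p => Submodule.span k (Set.range (F x p))) = Frame.span ∘ b :=
    funext fun x => funext fun p =>
      congrArg (Submodule.span k) ((e p).surjective.range_comp _).symm
  rw [heq]
  exact h

section Chart

variable {M : QuiverRep k Q} {I : Q → Type}

/-- The matrix whose rows are the images of the vectors of a frame under the maps `lam p`. The rows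
are indexed by `I p` along `e p`, so that the matrix is square. -/
def chartMatrix (lam : ∀ p : Q, M.space p →ₗ[k] (I p → k)) {d : Q → ℕ}
    (e : ∀ p, I p ≃ Fin (d p)) (b : Frame M d) (p : Q) : Matrix (I p) (I p) k :=
  Matrix.of fun i => lam p (b.1 p (e p i))

theorem regular_chartMatrix (lam : ∀ p : Q, M.space p →ₗ[k] (I p → k)) {d : Q → ℕ}
    (e : ∀ p, I p ≃ Fin (d p)) (p : Q) (i j : I p) :
    (frameVariety M d).IsRegular Set.univ (fun b => chartMatrix lam e b p i j) :=
  frameVariety_regular_coord _ p (e p i) ((LinearMap.proj j).comp (lam p))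

variable [∀ p, Fintype (I p)]

/-- The affine chart of the Grassmannians that belongs to a family of linear maps
`lam p : M p → k ^ I p`: the families of subspaces that are mapped isomorphically onto
`k ^ I p`. -/
def chart (lam : ∀ p : Q, M.space p →ₗ[k] (I p → k)) : Set (∀ p : Q, Submodule k (M.space p)) :=
  {U | ∀ p, finrank k (U p) = Fintype.card (I p) ∧ ∀ u ∈ U p, lam p u = 0 → u = 0}

theorem nonempty_equiv_of_span_mem_chart {d : Q → ℕ} {b : Frame M d}
    {lam : ∀ p : Q, M.space p →ₗ[k] (I p → k)} (h : b.span ∈ chart lam)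
    (p : Q) : Nonempty (I p ≃ Fin (d p)) :=
  ⟨Fintype.equivFinOfCardEq (by rw [← (h p).1, b.finrank_span])⟩

theorem exists_of_mem_chart {lam : ∀ p : Q, M.space p →ₗ[k] (I p → k)}
    {U : ∀ p : Q, Submodule k (M.space p)} (hU : U ∈ chart lam) (p : Q) (v : I p → k) :
    ∃ u ∈ U p, lam p u = v := by
  have hinj : Function.Injective ((lam p).domRestrict (U p)) := by
    refine (injective_iff_map_eq_zero _).2 fun u hu => ?_
    exact Subtype.ext ((hU p).2 u.1 u.2 hu)
  have := FiniteDimensional.of_injective _ hinj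
  have hsurj := (LinearMap.injective_iff_surjective_of_finrank_eq_finrank (by
    rw [(hU p).1, Module.finrank_fintype_fun_eq_card])).1 hinj
  obtain ⟨u, hu⟩ := hsurj v
  exact ⟨u.1, u.2, hu⟩

variable [∀ p, DecidableEq (I p)]

open Classical in
/-- The section over a chart: the basis of `U p` that is mapped to the standard basis of
`k ^ I p`, with value zero outside of the chart. -/
def chartSection (lam : ∀ p : Q, M.space p →ₗ[k] (I p → k)) (U : ∀ p : Q, Submodule k (M.space p))
    (p : Q) (i : I p) : M.space p :=
  if h : U ∈ chart lam then (exists_of_mem_chart h p (Pi.single i 1)).choose else 0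

variable {lam : ∀ p : Q, M.space p →ₗ[k] (I p → k)} {U : ∀ p : Q, Submodule k (M.space p)}

theorem chartSection_mem (hU : U ∈ chart lam) (p : Q) (i : I p) :
    chartSection lam U p i ∈ U p := by
  rw [chartSection, dif_pos hU]
  exact (exists_of_mem_chart hU p (Pi.single i 1)).choose_spec.1

theorem apply_chartSection (hU : U ∈ chart lam) (p : Q) (i : I p) :
    lam p (chartSection lam U p i) = Pi.single i 1 := by
  rw [chartSection, dif_pos hU]
  exact (exists_of_mem_chart hU p (Pi.single i 1)).choose_spec.2

theorem eq_chartSection (hU : U ∈ chart lam) {p : Q} {i : I p} {u : M.space p} (hu : u ∈ U p)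
    (h : lam p u = Pi.single i 1) : u = chartSection lam U p i := by
  refine sub_eq_zero.1 ((hU p).2 _ (sub_mem hu (chartSection_mem hU p i)) ?_)
  rw [map_sub, h, apply_chartSection hU, sub_self]

theorem linearIndependent_chartSection (hU : U ∈ chart lam) (p : Q) :
    LinearIndependent k (chartSection lam U p) := by
  refine LinearIndependent.of_comp (lam p) ?_
  have : lam p ∘ chartSection lam U p = fun i => Pi.single i 1 :=
    funext fun i => apply_chartSection hU p i
  rw [this]
  exact Pi.linearIndependent_single_one (I p) k

theorem span_chartSection [∀ p : Q, FiniteDimensional k (M.space p)] (hU : U ∈ chart lam)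
    (p : Q) : Submodule.span k (Set.range (chartSection lam U p)) = U p := by
  refine Submodule.eq_of_le_of_finrank_eq ?_ ?_
  · rw [Submodule.span_le]
    rintro _ ⟨i, rfl⟩
    exact chartSection_mem hU p i
  · rw [finrank_span_eq_card (linearIndependent_chartSection hU p), (hU p).1]

theorem span_mem_chart_iff {d : Q → ℕ} (e : ∀ p, I p ≃ Fin (d p)) (b : Frame M d) :
    b.span ∈ chart lam ↔ ∀ p, (chartMatrix lam e b p).det ≠ 0 := by
  refine forall_congr' fun p => ?_
  have hcard : finrank k (b.span p) = Fintype.card (I p) := by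
    rw [b.finrank_span, Fintype.card_congr (e p), Fintype.card_fin]
  rw [← isUnit_iff_ne_zero, ← Matrix.isUnit_iff_isUnit_det,
    ← Matrix.linearIndependent_rows_iff_isUnit]
  have hspan : b.span p = Submodule.span k (Set.range (b.1 p ∘ e p)) :=
    congrArg (Submodule.span k) ((e p).surjective.range_comp _).symm
  have hli : LinearIndependent k (b.1 p ∘ e p) := (b.2 p).comp _ (e p).injective
  constructor
  · rintro ⟨-, h⟩
    refine hli.map (f := lam p) ?_
    rw [← hspan, Submodule.disjoint_def]
    exact h
  · intro h
    refine ⟨hcard, fun u hu hu0 => ?_⟩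
    rw [hspan, Submodule.mem_span_range_iff_exists_fun] at hu
    obtain ⟨c, rfl⟩ := hu
    rw [map_sum] at hu0
    simp only [map_smul] at hu0
    have hc := Fintype.linearIndependent_iff.1 h c hu0
    simp [hc]

theorem isOpen_chart [Finite Q] (lam : ∀ p : Q, M.space p →ₗ[k] (I p → k)) :
    IsOpen[(grassmannians M).top] (chart lam) := by
  refine isOpen_iSup_iff.2 fun d => isOpen_coinduced.2 ?_
  refine (frameVariety M d).isOpen_of_forall_exists fun b₀ hb₀ => ?_
  let e := fun p => (nonempty_equiv_of_span_mem_chart hb₀ p).some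
  refine ⟨⋂ p, {b | (chartMatrix lam e b p).det ≠ 0}, ?_, ?_, fun b hb => ?_⟩
  · let := (frameVariety M d).top
    refine isOpen_iInter_of_finite fun p => ?_
    have := (frameVariety_isLocal M d Set.univ _ isOpen_univ
      (regular_det (regular_chartMatrix lam e p))).1
    simpa using this
  · exact Set.mem_iInter.2 ((span_mem_chart_iff e b₀).1 hb₀)
  · exact (span_mem_chart_iff e b).2 (Set.mem_iInter.1 hb)

theorem chartSection_span {d : Q → ℕ} (e : ∀ p, I p ≃ Fin (d p)) {b : Frame M d}
    (hb : b.span ∈ chart lam) (p : Q) (i : I p) :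
    chartSection lam b.span p i =
      ∑ j, (chartMatrix lam e b p)⁻¹ i j • b.1 p (e p j) := by
  refine (eq_chartSection hb ?_ ?_).symm
  · exact sum_mem fun j _ => Submodule.smul_mem _ _ (Submodule.subset_span ⟨_, rfl⟩)
  · have hdet := isUnit_iff_ne_zero.2 ((span_mem_chart_iff e b).1 hb p)
    have h := Matrix.nonsing_inv_mul _ hdet
    funext m
    have hm := congrFun (congrFun h i) m
    rw [Matrix.mul_apply] at hm
    rw [map_sum, Finset.sum_apply]
    simp only [map_smul, Pi.smul_apply, smul_eq_mul]
    refine hm.trans ?_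
    rw [Matrix.one_apply, Pi.single_apply]
    simp only [eq_comm]

/-- The section over a chart depends regularly on the family of subspaces. On the variety of frames
this is Cramer's rule. -/
theorem regular_chartSection (lam : ∀ p : Q, M.space p →ₗ[k] (I p → k)) (p : Q) (i : I p)
    (l : M.space p →ₗ[k] k) :
    (grassmannians M).IsRegular (chart lam) (fun U => l (chartSection lam U p i)) := by
  intro d
  by_cases h : ∃ b₀ : Frame M d, b₀.span ∈ chart lam
  · obtain ⟨b₀, hb₀⟩ := h
    let e := fun p => (nonempty_equiv_of_span_mem_chart hb₀ p).some
    have hinv := fun j => (frameVariety_isLocal M d).regular_inv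
      (@isOpen_univ _ (frameVariety M d).top) (regular_chartMatrix lam e p) i j
    refine (frameVariety M d).congr (fun b hb => ?_) (regular_sum (s := Finset.univ) fun j _ =>
      (frameVariety M d).mul ((frameVariety M d).mono (W' := Frame.span ⁻¹' chart lam) ?_ (hinv j))
        (frameVariety_regular_coord _ p (e p j) l))
    · rw [Function.comp_apply, chartSection_span e hb, map_sum]
      simp
    · exact fun b hb => ⟨trivial, (span_mem_chart_iff e b).1 hb p⟩
  · exact (frameVariety M d).glue fun b hb => absurd ⟨b, hb⟩ h

/-- The points of a set of subrepresentations that lie in a chart. -/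
def chartOn (lam : ∀ p : Q, M.space p →ₗ[k] (I p → k)) (Y : Set (SubRep M)) : Set Y :=
  {y | y.1.carrier ∈ chart lam}

theorem regular_chartSection_chartOn [Finite Q] (lam : ∀ p : Q, M.space p →ₗ[k] (I p → k))
    (Y : Set (SubRep M)) (p : Q) (i : I p) (l : M.space p →ₗ[k] k) :
    ((subvariety Y).induced (Subtype.val : chartOn lam Y → Y)).IsRegular Set.univ
      (fun y => l (chartSection lam y.1.1.carrier p i)) :=
  ((isMorphism_induced (grassmannians M) (fun U : Y => U.1.carrier)).comp
    (isMorphism_induced (subvariety Y) _)).regular_comp (isOpen_chart lam)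
      (regular_chartSection lam p i l) fun y => y.2

end Chart

/-! ### Morphisms between varieties of subrepresentations -/

/-- A map between varieties of subrepresentations is a morphism if locally, over charts, its values
are spanned by linearly independent vectors that depend regularly on the subrepresentation. -/
theorem isMorphism_subvariety [Finite Q] {M N : QuiverRep k Q} {Y : Set (SubRep M)}
    {Z : Set (SubRep N)} (φ : Y → Z)
    (h : ∀ y₀ : Y, ∃ (I : Q → Type) (_ : ∀ p, Fintype (I p)) (_ : ∀ p, DecidableEq (I p))
      (lam : ∀ p : Q, M.space p →ₗ[k] (I p → k)), y₀.1.carrier ∈ chart lam ∧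
      ∃ (J : Q → Type) (_ : ∀ p, Finite (J p)) (F : chartOn lam Y → ∀ p : Q, J p → N.space p),
        (∀ y p, LinearIndependent k (F y p)) ∧
        (∀ y p, Submodule.span k (Set.range (F y p)) = (φ y.1).1.carrier p) ∧
        ∀ (p : Q) (j : J p) (l : N.space p →ₗ[k] k),
          ((subvariety Y).induced (Subtype.val : chartOn lam Y → Y)).IsRegular Set.univ
            (fun y => l (F y p j))) :
    (subvariety Y).IsMorphism (subvariety Z) φ := by
  refine isMorphism_of_forall_exists fun y₀ => ?_
  obtain ⟨I, _, _, lam, hy₀, J, _, F, hF, hspan, hreg⟩ := h y₀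
  refine ⟨chartOn lam Y, (isMorphism_induced (grassmannians M) _).1 _ (isOpen_chart lam), hy₀, ?_⟩
  refine IsMorphism.to_induced ?_
  have h := isMorphism_span ((subvariety_isLocal Y).induced _) N F hF hreg
  convert h using 1
  funext y p
  exact (hspan y p).symm

/-- Every subspace has coordinates that extend to the ambient space. -/
theorem exists_injOn_linearMap {V : Type*} [AddCommGroup V] [Module k V] (U : Submodule k V)
    [FiniteDimensional k U] :
    ∃ μ : V →ₗ[k] (Fin (finrank k U) → k), ∀ u ∈ U, μ u = 0 → u = 0 := by
  obtain ⟨μ, hμ⟩ := (finBasis k U).equivFun.toLinearMap.exists_extend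
  refine ⟨μ, fun u hu h0 => ?_⟩
  have h := LinearMap.congr_fun hμ ⟨u, hu⟩
  have h' : (finBasis k U).equivFun ⟨u, hu⟩ = 0 := h.symm.trans h0
  simpa using h'

/-- Taking images under linear maps is a morphism where the dimensions are constant. -/
theorem isMorphism_map [Finite Q] {M N : QuiverRep k Q}
    [∀ p : Q, FiniteDimensional k (M.space p)] {Y : Set (SubRep M)} {Z : Set (SubRep N)}
    (g : ∀ p : Q, M.space p →ₗ[k] N.space p) (φ : Y → Z)
    (hφ : ∀ y p, (φ y).1.carrier p = (y.1.carrier p).map (g p))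
    (hdim : ∀ y y' p, finrank k ((φ y).1.carrier p) = finrank k ((φ y').1.carrier p)) :
    (subvariety Y).IsMorphism (subvariety Z) φ := by
  refine isMorphism_subvariety φ fun y₀ => ?_
  -- The chart is chosen so that part of its coordinates are coordinates on the image.
  choose μ hμ using fun p => exists_injOn_linearMap ((y₀.1.carrier p).map (g p))
  choose ν hν using fun p => exists_injOn_linearMap (y₀.1.carrier p ⊓ LinearMap.ker (g p))
  let I : Q → Type := fun p => Fin (finrank k ((y₀.1.carrier p).map (g p))) ⊕
    Fin (finrank k ↥(y₀.1.carrier p ⊓ LinearMap.ker (g p)))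
  let lam : ∀ p : Q, M.space p →ₗ[k] (I p → k) := fun p => LinearMap.pi fun i =>
    Sum.elim (fun i => (LinearMap.proj i).comp ((μ p).comp (g p)))
      (fun i => (LinearMap.proj i).comp (ν p)) i
  have hlam : ∀ p u i, lam p u (Sum.inl i) = μ p (g p u) i := fun _ _ _ => rfl
  have hli : ∀ (y : chartOn lam Y) p, LinearIndependent k
      (fun j => g p (chartSection lam y.1.1.carrier p (Sum.inl j))) := fun y p => by
    refine LinearIndependent.of_comp (μ p) ?_
    have : μ p ∘ (fun j => g p (chartSection lam y.1.1.carrier p (Sum.inl j))) =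
        fun j => Pi.single j 1 := by
      funext j m
      have h := congrFun (apply_chartSection y.2 p (Sum.inl j)) (Sum.inl m)
      rw [hlam] at h
      refine h.trans ?_
      rw [Pi.single_apply, Pi.single_apply]
      exact if_congr Sum.inl_injective.eq_iff rfl rfl
    rw [this]
    exact Pi.linearIndependent_single_one _ k
  refine ⟨I, inferInstance, inferInstance, lam, fun p => ⟨?_, fun u hu h0 => ?_⟩,
    fun p => Fin (finrank k ((y₀.1.carrier p).map (g p))), inferInstance,
    fun y p j => g p (chartSection lam y.1.1.carrier p (Sum.inl j)), hli, fun y p => ?_,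
    fun p j l => regular_chartSection_chartOn lam Y p (Sum.inl j) (l.comp (g p))⟩
  · have h := LinearMap.finrank_range_add_finrank_ker ((g p).domRestrict (y₀.1.carrier p))
    rw [LinearMap.range_domRestrict, LinearMap.ker_domRestrict] at h
    rw [← h, Fintype.card_sum, Fintype.card_fin, Fintype.card_fin]
    congr 1
    rw [← Submodule.map_comap_subtype, Submodule.finrank_map_subtype_eq]
  · have h1 : g p u = 0 := hμ p _ ⟨u, hu, rfl⟩ (funext fun i => congrFun h0 (Sum.inl i))
    exact hν p _ ⟨hu, h1⟩ (funext fun i => congrFun h0 (Sum.inr i))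
  · have : FiniteDimensional k ((φ y.1).1.carrier p) := by
      rw [hφ]
      infer_instance
    refine Submodule.eq_of_le_of_finrank_eq ?_ ?_
    · rw [hφ, Submodule.span_le]
      rintro _ ⟨j, rfl⟩
      exact ⟨_, chartSection_mem y.2 p (Sum.inl j), rfl⟩
    · rw [finrank_span_eq_card (hli y p), Fintype.card_fin, ← hφ y₀ p]
      exact hdim _ _ p

end QuiverRep

namespace QuiverRep

open SpaceWithFunctions

variable {k Q : Type u} [Field k] [Quiver.{u} Q]

/-- Taking preimages under surjective linear maps is a morphism: the preimage is spanned by a lift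
of a basis and a basis of the kernel. -/
theorem isMorphism_comap [Finite Q] {M N : QuiverRep k Q}
    [∀ p : Q, FiniteDimensional k (M.space p)] {Y : Set (SubRep M)} {Z : Set (SubRep N)}
    [∀ p : Q, FiniteDimensional k (N.space p)]
    (g : ∀ p : Q, N.space p →ₗ[k] M.space p) (hg : ∀ p, Function.Surjective (g p)) (φ : Y → Z)
    (hφ : ∀ y p, (φ y).1.carrier p = (y.1.carrier p).comap (g p)) :
    (subvariety Y).IsMorphism (subvariety Z) φ := by
  refine isMorphism_subvariety φ fun y₀ => ?_
  choose μ hμ using fun p => exists_injOn_linearMap (y₀.1.carrier p)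
  choose σ hσ using fun p =>
    (g p).exists_rightInverse_of_surjective (LinearMap.range_eq_top.2 (hg p))
  have hσ' : ∀ p x, g p (σ p x) = x := fun p x => LinearMap.congr_fun (hσ p) x
  let κ : ∀ p, Fin (finrank k (LinearMap.ker (g p))) → N.space p :=
    fun p j => (finBasis k (LinearMap.ker (g p)) j).1
  have hκ : ∀ p, LinearIndependent k (κ p) := fun p =>
    (finBasis k (LinearMap.ker (g p))).linearIndependent.map' (LinearMap.ker (g p)).subtype
      (Submodule.ker_subtype _)
  have hκs : ∀ p, Submodule.span k (Set.range (κ p)) = LinearMap.ker (g p) := fun p => by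
    have : Set.range (κ p) = (LinearMap.ker (g p)).subtype ''
        Set.range (finBasis k (LinearMap.ker (g p))) := Set.range_comp _ _
    rw [this, Submodule.span_image, Basis.span_eq, Submodule.map_top, Submodule.range_subtype]
  have hs : ∀ (y : chartOn μ Y) p,
      Submodule.span k (Set.range (σ p ∘ chartSection μ y.1.1.carrier p)) =
        (y.1.1.carrier p).map (σ p) := fun y p => by
    rw [Set.range_comp, Submodule.span_image, span_chartSection y.2]
  refine ⟨fun p => Fin (finrank k (y₀.1.carrier p)), inferInstance, inferInstance, μ,
    fun p => ⟨(Fintype.card_fin _).symm, hμ p⟩,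
    fun p => Fin (finrank k (y₀.1.carrier p)) ⊕ Fin (finrank k (LinearMap.ker (g p))),
    inferInstance, fun y p => Sum.elim (σ p ∘ chartSection μ y.1.1.carrier p) (κ p),
    fun y p => ?_, fun y p => ?_, ?_⟩
  · refine LinearIndependent.sum_type ?_ (hκ p) ?_
    · refine LinearIndependent.of_comp (g p) ?_
      rw [← Function.comp_assoc, ← LinearMap.coe_comp, hσ]
      exact linearIndependent_chartSection y.2 p
    · rw [hs, hκs, Submodule.disjoint_def]
      rintro _ ⟨x, -, rfl⟩ hx
      rw [LinearMap.mem_ker, hσ'] at hx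
      rw [hx, map_zero]
  · rw [Set.Sum.elim_range, Submodule.span_union, hs, hκs, hφ]
    refine le_antisymm (sup_le ?_ ?_) fun x hx => ?_
    · rintro _ ⟨x, hx, rfl⟩
      rwa [Submodule.mem_comap, hσ']
    · exact fun x hx => by
        rw [Submodule.mem_comap, LinearMap.mem_ker.1 hx]
        exact zero_mem _
    · refine Submodule.mem_sup.2 ⟨σ p (g p x), ⟨_, hx, rfl⟩, x - σ p (g p x), ?_, by abel⟩
      rw [LinearMap.mem_ker, map_sub, hσ', sub_self]
  · rintro p (j | j) l
    · exact regular_chartSection_chartOn μ Y p j (l.comp (σ p))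
    · exact ((subvariety Y).induced _).const _ (l (κ p j))

/-! ### Spaces of morphisms -/

/-- The value of a morphism of representations at a vector, as a linear map. -/
def homEval (M N : QuiverRep k Q) (p : Q) (x : M.space p) : (M ⟶ N) →ₗ[k] N.space p where
  toFun φ := component φ p x
  map_add' φ ψ := component_add φ ψ p x
  map_smul' c φ := component_smul c φ p x

/-- The values of a morphism of representations at a family of vectors. -/
def homValues (M N : QuiverRep k Q) {J : Q → Type*} (v : ∀ p : Q, J p → M.space p) :
    (M ⟶ N) →ₗ[k] ∀ p : Q, J p → N.space p :=
  LinearMap.pi fun p => LinearMap.pi fun j => homEval M N p (v p j)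

theorem homValues_injective (M N : QuiverRep k Q) {J : Q → Type*} (v : ∀ p : Q, J p → M.space p)
    (hv : ∀ p, Submodule.span k (Set.range (v p)) = ⊤) :
    Function.Injective (homValues M N v) := by
  intro φ ψ h
  refine hom_ext fun p => LinearMap.congr_fun (LinearMap.ext_on_range (hv p) fun j => ?_)
  exact congrFun (congrFun h p) j

theorem finiteDimensional_hom [Finite Q] (M N : QuiverRep k Q)
    [∀ p : Q, FiniteDimensional k (M.space p)] [∀ p : Q, FiniteDimensional k (N.space p)] :
    FiniteDimensional k (M ⟶ N) :=
  FiniteDimensional.of_injective (homValues M N fun p => finBasis k (M.space p))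
    (homValues_injective M N _ fun p => (finBasis k (M.space p)).span_eq)

theorem SubRep.coe_toRep_arrow {M : QuiverRep k Q} (U : SubRep M) {p r : Q} (a : p ⟶ r)
    (x : U.carrier p) : (U.toRep.arrow a x : U.carrier r).1 = M.arrow a x.1 :=
  congrArg Subtype.val (ofArrows_arrow (fun p => U.carrier p)
    (fun a => (M.arrow a).restrict (U.stable a)) a x)

theorem SubRep.component_lift {B N : QuiverRep k Q} {π : B ⟶ N} {V : SubRep N}
    {s : V.toRep ⟶ B} (hs : s ≫ π = V.incl) (p : Q) (v : V.carrier p) :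
    component π p (component s p v) = v.1 :=
  congrArg (fun f : V.toRep ⟶ N => component f p v) hs

/-- The image of a morphism of representations. -/
def rangeSubRep {M N : QuiverRep k Q} (φ : M ⟶ N) : SubRep N where
  carrier p := LinearMap.range (component φ p)
  stable a x hx := by
    obtain ⟨y, rfl⟩ := hx
    exact ⟨M.arrow a y, component_arrow φ a y⟩

/-! ### Complements of the kernel as lifts -/

section Fibre

variable {S B N : QuiverRep k Q} {i : S ⟶ B} {π : B ⟶ N}

/-- The fibre of `U ↦ π(U)` over `V`, on the subrepresentations that meet the image of `i` in
zero. -/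
def fibre (i : S ⟶ B) (π : B ⟶ N) (e : Q → ℤ) (V : SubRep N) : Set (SubRep B) :=
  {U ∈ grDisjoint i e | U.map π = V}

theorem rangeSubRep_mem_fibre (w : i ≫ π = 0) {e : Q → ℤ} {V : SubRep N} (hV : V ∈ gr N e)
    {s : V.toRep ⟶ B} (hs : s ≫ π = V.incl) : rangeSubRep s ∈ fibre i π e V := by
  have hs' : ∀ (p : Q) (v : V.carrier p), component π p (component s p v) = v.1 :=
    SubRep.component_lift hs
  refine ⟨⟨fun p => ?_, fun p => ?_⟩, ?_⟩
  · have hinj : Function.Injective (component s p) := fun v v' h => by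
      have h' := congrArg (component π p) h
      exact Subtype.ext (((hs' p v).symm.trans h').trans (hs' p v'))
    exact (congrArg Nat.cast (LinearMap.finrank_range_of_inj hinj)).trans (hV p)
  · refine (Submodule.eq_bot_iff _).2 ?_
    rintro x ⟨⟨v, rfl⟩, y, hy⟩
    have h := hs' p v
    rw [← hy, ← component_comp, w, component_zero] at h
    have hv : v = 0 := Subtype.ext h.symm
    rw [hv, map_zero]
  · refine SubRep.ext (funext fun p => le_antisymm ?_ fun x hx => ?_)
    · rintro _ ⟨_, ⟨v, rfl⟩, rfl⟩
      rw [hs' p v]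
      exact v.2
    · exact ⟨_, ⟨⟨x, hx⟩, rfl⟩, hs' p ⟨x, hx⟩⟩

/-- A subrepresentation in the fibre over `V` is mapped isomorphically to `V` by `π`, and the
inverse is a lift of the inclusion of `V`. -/
theorem exists_lift_of_mem_fibre {w : i ≫ π = 0} (exact : (ShortComplex.mk i π w).ShortExact)
    {e : Q → ℤ} {V : SubRep N} {U : SubRep B} (hU : U ∈ fibre i π e V) :
    ∃ s : V.toRep ⟶ B, s ≫ π = V.incl ∧ rangeSubRep s = U := by
  have hinj : ∀ p, ∀ x ∈ U.carrier p, component π p x = 0 → x = 0 := fun p x hx h0 => by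
    have h : x ∈ U.carrier p ⊓ LinearMap.range (component i p) :=
      ⟨hx, (range_component_eq_ker exact p).symm ▸ h0⟩
    rw [hU.1.2 p] at h
    exact h
  have hmap : ∀ p, (U.carrier p).map (component π p) = V.carrier p := fun p =>
    congrFun (congrArg SubRep.carrier hU.2) p
  let E : ∀ p, U.carrier p ≃ₗ[k] V.carrier p := fun p => LinearEquiv.ofBijective
    ((component π p).restrict (p := U.carrier p) (q := V.carrier p)
      fun x hx => hmap p ▸ ⟨x, hx, rfl⟩) ⟨by
        refine (injective_iff_map_eq_zero _).2 fun x hx => ?_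
        exact Subtype.ext (hinj p x.1 x.2 (congrArg Subtype.val hx)), fun v => by
        obtain ⟨x, hx, hxv⟩ := (hmap p).ge v.2
        exact ⟨⟨x, hx⟩, Subtype.ext hxv⟩⟩
  have hE : ∀ p (v : V.carrier p), component π p ((E p).symm v).1 = v.1 := fun p v =>
    congrArg Subtype.val ((E p).apply_symm_apply v)
  let s : V.toRep ⟶ B := homMk (fun p => (U.carrier p).subtype.comp (E p).symm.toLinearMap)
    fun {p r} a x => by
      refine sub_eq_zero.1 (hinj r _ (sub_mem (Subtype.property _)
        (U.stable a _ (Subtype.property _))) ?_)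
      rw [map_sub, component_arrow, sub_eq_zero]
      refine (hE r _).trans ((V.coe_toRep_arrow a x).trans ?_)
      exact congrArg (N.arrow a) (hE p x).symm
  refine ⟨s, hom_ext fun p v => hE p v, SubRep.ext (funext fun p => ?_)⟩
  refine le_antisymm ?_ fun x hx => ⟨E p ⟨x, hx⟩, ?_⟩
  · rintro _ ⟨v, rfl⟩
    exact ((E p).symm v).2
  · exact congrArg Subtype.val ((E p).symm_apply_apply ⟨x, hx⟩)

/-- If the inclusion of `V` has a lift `s₀`, then the fibre over `V` is an affine space: its points
are the images of the lifts `s₀ + h ≫ i` for `h : V ⟶ S`. -/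
theorem fibre_isomorphic_affine [Finite Q] [∀ p : Q, FiniteDimensional k (B.space p)]
    [∀ p : Q, FiniteDimensional k (S.space p)] [∀ p : Q, FiniteDimensional k (N.space p)]
    {w : i ≫ π = 0} (exact : (ShortComplex.mk i π w).ShortExact) {e : Q → ℤ} {V : SubRep N}
    (hV : V ∈ gr N e) (s₀ : V.toRep ⟶ B) (hs₀ : s₀ ≫ π = V.incl) :
    (subvariety (fibre i π e V)).Isomorphic
      (affineVariety k (Fin (finrank k (V.toRep ⟶ S)) → k)) := by
  have hfd : ∀ p : Q, FiniteDimensional k (V.toRep.space p) := fun p =>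
    inferInstanceAs (FiniteDimensional k (V.carrier p))
  have hfin : FiniteDimensional k (V.toRep ⟶ S) := finiteDimensional_hom _ _
  have hi : Mono i := exact.mono_f
  let c := (finBasis k (V.toRep ⟶ S)).equivFun
  let lift : (V.toRep ⟶ S) → (V.toRep ⟶ B) := fun h => s₀ + h ≫ i
  have hlift : ∀ h, lift h ≫ π = V.incl := fun h => by
    rw [Preadditive.add_comp, Category.assoc, w, Limits.comp_zero, add_zero, hs₀]
  have hlift' : ∀ h (p : Q) (v : V.carrier p), component π p (component (lift h) p v) = v.1 :=
    fun h => SubRep.component_lift (hlift h)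
  let ψ : (Fin (finrank k (V.toRep ⟶ S)) → k) → fibre i π e V := fun t =>
    ⟨rangeSubRep (lift (c.symm t)), rangeSubRep_mem_fibre w hV (hlift _)⟩
  have hψ_surj : Function.Surjective ψ := by
    rintro ⟨U, hU⟩
    obtain ⟨s, hs, rfl⟩ := exists_lift_of_mem_fibre exact hU
    have h0 : (s - s₀) ≫ π = 0 := by rw [Preadditive.sub_comp, hs, hs₀, sub_self]
    have hlifts : lift (exact.exact.lift (s - s₀) h0) = s := by
      have h1 : exact.exact.lift (s - s₀) h0 ≫ i = s - s₀ := exact.exact.lift_f _ _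
      change s₀ + exact.exact.lift (s - s₀) h0 ≫ i = s
      rw [h1, add_sub_cancel]
    refine ⟨c (exact.exact.lift (s - s₀) h0), Subtype.ext ?_⟩
    change rangeSubRep (lift (c.symm (c _))) = _
    rw [c.symm_apply_apply, hlifts]
  -- The coordinates dual to a basis of `V` define a chart of the Grassmannians of `B` that contains
  -- the whole fibre; the section takes the image of `s` to the lift of the basis by `s`.
  let v : ∀ p : Q, Fin (finrank k (V.carrier p)) → V.carrier p := fun p => finBasis k (V.carrier p)
  choose μ hμ using fun p => (finBasis k (V.carrier p)).equivFun.toLinearMap.exists_extend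
  have hμ' : ∀ p (x : V.carrier p), μ p x.1 = (finBasis k (V.carrier p)).equivFun x :=
    fun p x => LinearMap.congr_fun (hμ p) x
  let lam : ∀ p : Q, B.space p →ₗ[k] (Fin (finrank k (V.carrier p)) → k) :=
    fun p => (μ p).comp (component π p)
  have hlam : ∀ h (p : Q) j, lam p (component (lift h) p (v p j)) = Pi.single j 1 :=
    fun h p j => by
      change μ p (component π p (component (lift h) p (v p j))) = _
      rw [hlift' h p (v p j), hμ']
      refine ((finBasis k (V.carrier p)).equivFun_apply _).trans ?_
      rw [Basis.repr_self, Finsupp.single_eq_pi_single]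
  have hchart : ∀ U : fibre i π e V, U.1.carrier ∈ chart lam := by
    intro U p
    obtain ⟨t, rfl⟩ := hψ_surj U
    refine ⟨?_, ?_⟩
    · have h := (ψ t).2.1.1 p
      rw [← hV p, Nat.cast_inj] at h
      rw [h, Fintype.card_fin]
    · rintro _ ⟨x, rfl⟩ h0
      have h1 : μ p (component π p (component (lift (c.symm t)) p x)) = 0 := h0
      rw [hlift' _ p x, hμ' p x] at h1
      have hx : x = 0 := (finBasis k (V.carrier p)).equivFun.map_eq_zero_iff.1 h1
      rw [hx, map_zero]
  have hsec : ∀ t (p : Q) j, chartSection lam (ψ t).1.carrier p j =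
      component (lift (c.symm t)) p (v p j) := fun t p j =>
    (eq_chartSection (hchart (ψ t)) ⟨_, rfl⟩ (hlam _ p j)).symm
  -- Subtracting `s₀` from this lift of the basis leaves the values of `h` on the basis.
  choose κ hκ using fun p : Q => (component i p).exists_leftInverse_of_injective
    (LinearMap.ker_eq_bot.2 (injective_component_of_mono i p))
  obtain ⟨L, hL⟩ := (homValues V.toRep S v).exists_leftInverse_of_injective
    (LinearMap.ker_eq_bot.2 (homValues_injective _ _ _ fun p => (finBasis k (V.carrier p)).span_eq))
  let x : fibre i π e V → ∀ p : Q, Fin (finrank k (V.carrier p)) → S.space p := fun U p j =>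
    κ p (chartSection lam U.1.carrier p j - component s₀ p (v p j))
  let φ : fibre i π e V → (Fin (finrank k (V.toRep ⟶ S)) → k) := fun U => c (L (x U))
  have hφψ : Function.LeftInverse φ ψ := fun t => by
    have hx : x (ψ t) = homValues V.toRep S v (c.symm t) := by
      funext p j
      change κ p (chartSection lam (ψ t).1.carrier p j - component s₀ p (v p j)) =
        component (c.symm t) p (v p j)
      rw [hsec]
      refine (congrArg (κ p) ?_).trans (LinearMap.congr_fun (hκ p) (component (c.symm t) p (v p j)))
      exact add_sub_cancel_left _ _
    change c (L (x (ψ t))) = t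
    rw [hx]
    exact (congrArg c (LinearMap.congr_fun hL (c.symm t))).trans (c.apply_symm_apply t)
  have hx : (subvariety (fibre i π e V)).IsMorphism (affineVariety k _) x := by
    refine (subvariety_isLocal _).isMorphism_affine_pi fun p j l => ?_
    have h := ((isMorphism_induced (grassmannians B)
      (fun U : fibre i π e V => U.1.carrier)).regular_comp (isOpen_chart lam)
        (regular_chartSection lam p j (l.comp (κ p))) hchart)
    refine (subvariety _).congr (fun U _ => ?_) ((subvariety _).add h
      ((subvariety _).const _ (- l (κ p (component s₀ p (v p j))))))
    change l (κ p _) + - l (κ p _) = l (κ p _)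
    rw [map_sub, map_sub, sub_eq_add_neg]
  refine ⟨φ, ⟨?_, ψ, ?_, ?_, hφψ⟩⟩
  · refine (subvariety_isLocal _).isMorphism_affine fun l => ?_
    exact hx.regular_comp_univ (affineVariety_regular_linear
      (l.comp (c.toLinearMap.comp L)) Set.univ)
  · refine IsMorphism.to_induced ?_
    have hli : ∀ t p, LinearIndependent k (fun j => component (lift (c.symm t)) p (v p j)) :=
      fun t p => by
        refine LinearIndependent.of_comp (component π p) ?_
        have : component π p ∘ (fun j => component (lift (c.symm t)) p (v p j)) =
            (V.carrier p).subtype ∘ v p := funext fun j => hlift' _ p (v p j)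
        rw [this]
        exact (finBasis k (V.carrier p)).linearIndependent.map' _ (Submodule.ker_subtype _)
    have h := isMorphism_span (affineVariety_isLocal k (Fin (finrank k (V.toRep ⟶ S)) → k)) B
      (fun t p j => component (lift (c.symm t)) p (v p j)) hli fun p j l => ?_
    · convert h using 1
      funext t p
      change LinearMap.range (component (lift (c.symm t)) p) = _
      have : Set.range (fun j => component (lift (c.symm t)) p (v p j)) =
          component (lift (c.symm t)) p '' Set.range (v p) := Set.range_comp _ _
      rw [this, Submodule.span_image]
      exact (Submodule.map_top _).symm.trans
        (congrArg _ (finBasis k (V.carrier p)).span_eq.symm)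
    · refine (affineVariety k _).congr (fun t _ => ?_) ((affineVariety k _).add
        ((affineVariety k _).const _ (l (component s₀ p (v p j))))
        (affineVariety_regular_linear (l.comp ((component i p).comp
          ((homEval _ _ p (v p j)).comp c.symm.toLinearMap))) _))
      exact (map_add l _ _).symm
  · intro U
    obtain ⟨t, rfl⟩ := hψ_surj U
    rw [hφψ]

end Fibre

end QuiverRep

/-! ### The images and preimages along `π` -/

namespace QuiverRep

variable {k Q : Type u} [Field k] [Quiver.{u} Q]

instance (q p : Q) : FiniteDimensional k ((simple k q).space p) :=
  inferInstanceAs (FiniteDimensional k (PLift (p = q) → k))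

theorem gr_dimVec (M : QuiverRep k Q) [∀ p : Q, FiniteDimensional k (M.space p)] :
    gr M M.dimVec = {⟨fun _ => ⊤, fun _ _ _ => trivial⟩} := by
  refine Set.eq_singleton_iff_unique_mem.2 ⟨fun p => by rw [finrank_top]; rfl, fun U hU => ?_⟩
  exact SubRep.ext (funext fun p => Submodule.eq_top_of_finrank_eq (Nat.cast_inj.1 (hU p)))

theorem gr_zero (M : QuiverRep k Q) [∀ p : Q, FiniteDimensional k (M.space p)] :
    gr M 0 = {⟨fun _ => ⊥, fun a x hx => by
      rw [(Submodule.mem_bot k).1 hx, map_zero]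
      exact zero_mem _⟩} := by
  refine Set.eq_singleton_iff_unique_mem.2 ⟨fun p => by simp, fun U hU => ?_⟩
  exact SubRep.ext (funext fun p => Submodule.finrank_eq_zero.1 (Nat.cast_eq_zero.1 (hU p)))

section Psi

variable {S B N : QuiverRep k Q} {i : S ⟶ B} {π : B ⟶ N} {e : Q → ℤ}

theorem comap_mem_gr_dimVec {U : SubRep B} (hU : U ∈ grContaining i e) :
    U.comap i ∈ gr S S.dimVec := fun p => by
  have h : (U.comap i).carrier p = ⊤ :=
    Submodule.eq_top_iff'.2 fun x => hU.2 p ⟨x, rfl⟩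
  rw [h, finrank_top]
  rfl

theorem comap_mem_gr_zero [Mono i] {U : SubRep B} (hU : U ∈ grDisjoint i e) :
    U.comap i ∈ gr S 0 := fun p => by
  have h : (U.comap i).carrier p = ⊥ := by
    refine (Submodule.eq_bot_iff _).2 fun x hx => ?_
    have hx' : component i p x ∈ U.carrier p ⊓ LinearMap.range (component i p) := ⟨hx, x, rfl⟩
    rw [hU.2 p, Submodule.mem_bot] at hx'
    exact injective_component_of_mono i p (hx'.trans (map_zero _).symm)
  rw [h, finrank_bot]
  rfl

variable {w : i ≫ π = 0}

theorem finrank_comap_component [∀ p : Q, FiniteDimensional k (B.space p)]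
    (exact : (ShortComplex.mk i π w).ShortExact) (V : SubRep N) (p : Q) :
    finrank k ((V.carrier p).comap (component π p)) =
      finrank k (V.carrier p) + finrank k (S.space p) := by
  have hi : Mono i := exact.mono_f
  have hπ : Epi π := exact.epi_g
  have h := LinearMap.finrank_range_add_finrank_ker
    ((component π p).domRestrict ((V.carrier p).comap (component π p)))
  rw [LinearMap.range_domRestrict, LinearMap.ker_domRestrict,
    Submodule.map_comap_eq_of_surjective (surjective_component_of_epi π p)] at h
  rw [← h]
  congr 1
  rw [← LinearMap.finrank_range_of_inj (injective_component_of_mono i p),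
    range_component_eq_ker exact p, ← Submodule.finrank_map_subtype_eq,
    Submodule.map_comap_subtype, inf_eq_right.2]
  exact Submodule.comap_mono bot_le

theorem comap_map_of_mem_grContaining (exact : (ShortComplex.mk i π w).ShortExact)
    {U : SubRep B} (hU : U ∈ grContaining i e) (p : Q) :
    ((U.map π).carrier p).comap (component π p) = U.carrier p := by
  refine (Submodule.comap_map_eq _ _).trans (sup_eq_left.2 ?_)
  rw [← range_component_eq_ker exact p]
  exact hU.2 p

theorem map_mem_gr_of_mem_grContaining [∀ p : Q, FiniteDimensional k (B.space p)]
    (exact : (ShortComplex.mk i π w).ShortExact) {U : SubRep B}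
    (hU : U ∈ grContaining i e) : U.map π ∈ gr N (e - S.dimVec) := fun p => by
  have h := finrank_comap_component exact (U.map π) p
  rw [comap_map_of_mem_grContaining exact hU] at h
  have h' := hU.1 p
  rw [h, Nat.cast_add] at h'
  exact eq_sub_of_add_eq h'

theorem comap_mem_grContaining [∀ p : Q, FiniteDimensional k (B.space p)]
    (exact : (ShortComplex.mk i π w).ShortExact) {V : SubRep N}
    (hV : V ∈ gr N (e - S.dimVec)) : V.comap π ∈ grContaining i e := by
  refine ⟨fun p => ?_, fun p => ?_⟩
  · refine (congrArg Nat.cast (finrank_comap_component exact V p)).trans ?_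
    rw [Nat.cast_add, hV p]
    exact sub_add_cancel (e p) _
  · rw [range_component_eq_ker exact p]
    exact Submodule.comap_mono bot_le

theorem map_mem_gr_of_mem_grDisjoint (exact : (ShortComplex.mk i π w).ShortExact)
    {U : SubRep B} (hU : U ∈ grDisjoint i e) :
    U.map π ∈ gr N e := fun p => by
  rw [← hU.1 p]
  refine congrArg Nat.cast ?_
  have hinj : Function.Injective ((component π p).domRestrict (U.carrier p)) := by
    refine (injective_iff_map_eq_zero _).2 fun x hx => ?_
    have h : x.1 ∈ U.carrier p ⊓ LinearMap.range (component i p) :=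
      ⟨x.2, (range_component_eq_ker exact p).symm ▸ hx⟩
    rw [hU.2 p] at h
    exact Subtype.ext h
  rw [← LinearMap.finrank_range_of_inj hinj, LinearMap.range_domRestrict]
  rfl

theorem isIsomorphism_grContaining [Finite Q] [∀ p : Q, FiniteDimensional k (B.space p)]
    [∀ p : Q, FiniteDimensional k (N.space p)]
    (exact : (ShortComplex.mk i π w).ShortExact)
    (h : Set.MapsTo (fun U => (psi i π U).2) (grContaining i e) (gr N (e - S.dimVec))) :
    (subvariety (grContaining i e)).IsIsomorphism (subvariety (gr N (e - S.dimVec)))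
      (h.restrict _ _ _) := by
  have hπ : Epi π := exact.epi_g
  refine ⟨isMorphism_map (component π) _ (fun _ _ => rfl) fun y y' p => ?_,
    fun V => ⟨V.1.comap π, comap_mem_grContaining exact V.2⟩,
    isMorphism_comap (component π) (surjective_component_of_epi π) _ fun _ _ => rfl,
    fun U => ?_, fun V => ?_⟩
  · exact Nat.cast_inj.1 ((h y.2 p).trans (h y'.2 p).symm)
  · exact Subtype.ext (SubRep.ext (funext (comap_map_of_mem_grContaining exact U.2)))
  · exact Subtype.ext (SubRep.ext (funext fun p =>
      Submodule.map_comap_eq_of_surjective (surjective_component_of_epi π p) _))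

end Psi

end QuiverRep

end

theorem mainTheorem11 {k Q : Type u} [Field k] [IsAlgClosed k] [Quiver.{u} Q] [Finite Q]
    [∀ p r : Q, Finite (p ⟶ r)]
    (acyclic : ∀ (p : Q) (c : Quiver.Path p p), c.length = 0)
    (q : Q) (B N : QuiverRep k Q) [∀ p : Q, FiniteDimensional k (QuiverRep.space B p)]
    (i : QuiverRep.simple k q ⟶ B) (π : B ⟶ N) (w : i ≫ π = 0)
    (exact : (ShortComplex.mk i π w).ShortExact)
    (hom_one : finrank k (QuiverRep.simple k q ⟶ B) = 1)
    (ext_zero : Subsingleton (Abelian.Ext B (QuiverRep.simple k q) 1))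
    (e : Q → ℤ) :
    -- `Gr_{s_q}(S_q)` and `Gr_0(S_q)` are points
    (∃ A, QuiverRep.gr (QuiverRep.simple k q) (QuiverRep.simple k q).dimVec = {A}) ∧
    (∃ A, QuiverRep.gr (QuiverRep.simple k q) 0 = {A}) ∧
    -- the first map is well defined and an isomorphism
    (∀ U ∈ QuiverRep.grContaining i e,
      (QuiverRep.psi i π U).1 ∈
        QuiverRep.gr (QuiverRep.simple k q) (QuiverRep.simple k q).dimVec) ∧
    (∃ h : Set.MapsTo (fun U => (QuiverRep.psi i π U).2) (QuiverRep.grContaining i e)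
        (QuiverRep.gr N (e - (QuiverRep.simple k q).dimVec)),
      (QuiverRep.subvariety (QuiverRep.grContaining i e)).IsIsomorphism
        (QuiverRep.subvariety (QuiverRep.gr N (e - (QuiverRep.simple k q).dimVec)))
        (h.restrict _ _ _)) ∧
    -- the second map is well defined and a morphism
    (∀ U ∈ QuiverRep.grDisjoint i e,
      (QuiverRep.psi i π U).1 ∈ QuiverRep.gr (QuiverRep.simple k q) 0) ∧
    (∃ h : Set.MapsTo (fun U => (QuiverRep.psi i π U).2) (QuiverRep.grDisjoint i e)
        (QuiverRep.gr N e),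
      (QuiverRep.subvariety (QuiverRep.grDisjoint i e)).IsMorphism
        (QuiverRep.subvariety (QuiverRep.gr N e)) (h.restrict _ _ _)) ∧
    -- the fibres of the second map
    ∀ V ∈ QuiverRep.gr N e,
      (¬ Subsingleton (Abelian.Ext V.toRep (QuiverRep.simple k q) 1) →
        {U ∈ QuiverRep.grDisjoint i e | (QuiverRep.psi i π U).2 = V} = ∅) ∧
      (Subsingleton (Abelian.Ext V.toRep (QuiverRep.simple k q) 1) →
        (QuiverRep.subvariety
          {U ∈ QuiverRep.grDisjoint i e | (QuiverRep.psi i π U).2 = V}).Isomorphic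
          (affineVariety k (Fin (finrank k (V.toRep ⟶ QuiverRep.simple k q)) → k))) := by
  have hi : Mono i := exact.mono_f
  have hπ : Epi π := exact.epi_g
  have hN : ∀ p : Q, FiniteDimensional k (N.space p) := fun p =>
    Module.Finite.of_surjective _ (QuiverRep.surjective_component_of_epi π p)
  have hq : Set.MapsTo (fun U => (QuiverRep.psi i π U).2) (QuiverRep.grContaining i e)
      (QuiverRep.gr N (e - (QuiverRep.simple k q).dimVec)) :=
    fun U hU => QuiverRep.map_mem_gr_of_mem_grContaining exact hU
  have h0 : Set.MapsTo (fun U => (QuiverRep.psi i π U).2) (QuiverRep.grDisjoint i e)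
      (QuiverRep.gr N e) :=
    fun U hU => QuiverRep.map_mem_gr_of_mem_grDisjoint exact hU
  refine ⟨⟨_, QuiverRep.gr_dimVec _⟩, ⟨_, QuiverRep.gr_zero _⟩,
    fun U hU => QuiverRep.comap_mem_gr_dimVec hU,
    ⟨hq, QuiverRep.isIsomorphism_grContaining exact hq⟩,
    fun U hU => QuiverRep.comap_mem_gr_zero hU,
    ⟨h0, QuiverRep.isMorphism_map (QuiverRep.component π) _ (fun _ _ => rfl) fun y y' p =>
      Nat.cast_inj.1 ((h0 y.2 p).trans (h0 y'.2 p).symm)⟩,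
    fun V hV => ⟨fun hExt => ?_, fun hExt => ?_⟩⟩
  · refine Set.eq_empty_of_forall_notMem fun U hU => hExt ?_
    obtain ⟨s, hs, -⟩ := QuiverRep.exists_lift_of_mem_fibre exact hU
    have : Mono (s ≫ π) := hs ▸ inferInstance
    exact QuiverRep.subsingleton_ext_of_lift exact ext_zero s
  · obtain ⟨s₀, hs₀⟩ := QuiverRep.exists_lift_of_subsingleton_ext exact V.incl hExt
    exact QuiverRep.fibre_isomorphic_affine exact hV s₀ hs₀
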